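/- Let $n\in\mathbb N$ and let $V=\mathbf v(\Gamma,\theta_V)\neq 0$ be an integer $1$-rectifiable varifold in $\mathbb R^n$: $\Gamma\subset\mathbb R^n$ is $\mathcal H^1$-measurable and, up to an $\mathcal H^1$-null set, covered by countably many Lipschitz images of $\mathbb R$; $\theta_V$ is $\mathcal H^1$-measurable with values in $\{1,2,\dots\}$ on $\Gamma$ and is extended by $0$ outside $\Gamma$; and the weight measure $\mu_V=\theta_V\,\mathcal H^1\llcorner\Gamma$ is locally finite. Let $T_x\Gamma$ denote the approximate tangent line of $\Gamma$ (with respect to $\theta_V$), which exists at $\mu_V$-a.e. $x$. Assume that $V$ has generalized curvature $k_V\in L^1_{\mathrm{loc}}(\mu_V;\mathbb R^n)$ and no generalized boundary, that is, $$\int \mathrm{div}_{T_x\Gamma}X\,d\mu_V=-\int\langle X,k_V\rangle\,d\mu_V\qquad\text{for all }X\in C^1_c(\mathbb R^n;\mathbb R^n).$$ For $q\in[1,\infty)$ write $\mathcal E_q(V)=\int|k_V|^q\,d\mu_V\in[0,\infty]$, and assume that $\mathcal E_p(V)<\infty$ for some $p\in[1,\infty)$. Let $B_r(x)$ be the open ball,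 and let $\frac1{p'}=1-\frac1p$ (so $\frac1{p'}=0$ if $p=1$). (1) For every $x_0\in\mathbb R^n$, $$\limsup_{\sigma\searrow0}\frac{\mu_V(B_\sigma(x_0))}{\sigma}\le\liminf_{\rho\nearrow\infty}\left(\frac{\mu_V(B_\rho(x_0))}{\rho}+\int_{B_\rho(x_0)}|k_V|\,d\mu_V\right).$$ (2) If $\mu_V(\mathbb R^n)<\infty$, then $$2\le\mathcal E_1(V)\le\mu_V(\mathbb R^n)^{1/p'}\,\mathcal E_p(V)^{1/p}.$$ (3) If $\mu_V(\mathbb R^n)<\infty$ and $p>1$, then the density $\Theta(x)=\lim_{r\searrow0}\frac{\mu_V(B_r(x))}{2r}$ exists at every $x\in\mathbb R^n$, it agrees with $\theta_V(x)$ for $\mathcal H^1$-a.e. $x$ (so that it can be used as multiplicity function of $V$), and $\Theta(x)\le\frac12\mathcal E_1(V)$ for every $x\in\mathbb R^n$. (4) If $\mu_V(\mathbb R^n)<\infty$ and $p=1$, then $\theta_V(x)\le\frac12\mathcal E_1(V)$ for $\mathcal H^1$-a.e. $x\in\mathbb R^n$. (5) If $\mu_V(\mathbb R^n)<\infty$,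 $p=1$ and $\Gamma$ is essentially bounded, i.e. $\mathcal H^1(\Gamma\setminus B_R(0))=0$ for some $R$, then the density $\Theta(x)=\lim_{r\searrow0}\frac{\mu_V(B_r(x))}{2r}$ exists at every $x\in\mathbb R^n$, it agrees with $\theta_V(x)$ for $\mathcal H^1$-a.e. $x$, and $\Theta(x)\le\frac12\mathcal E_1(V)$ for every $x\in\mathbb R^n$. -/

import Mathlib

open MeasureTheory Set Filter Topology
open scoped ENNReal

/-- An integer `1`-rectifiable varifold `v(Γ, θ)` in `ℝⁿ`: `Γ` is an `ℋ¹`-measurable, countably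
`1`-rectifiable set, and the multiplicity `θ` is an `ℋ¹`-measurable function with values in
`{1, 2, …}` on `Γ`, extended by `0` outside `Γ`, such that `θ ℋ¹ ⌞ Γ` is locally finite. -/
structure IntegerRectifiableVarifold (n : ℕ) where
  /-- the set `Γ` -/
  carrier : Set (EuclideanSpace ℝ (Fin n))
  /-- the multiplicity function `θ` -/
  mult : EuclideanSpace ℝ (Fin n) → ℕ
  carrier_measurable : NullMeasurableSet carrier (Measure.hausdorffMeasure 1)
  mult_measurable : AEMeasurable mult ((Measure.hausdorffMeasure 1).restrict carrier)
  one_le_mult : ∀ x ∈ carrier, 1 ≤ mult x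
  mult_eq_zero : ∀ x ∉ carrier, mult x = 0
  /-- up to an `ℋ¹`-null set, `Γ` is covered by countably many Lipschitz images of `ℝ` -/
  rectifiable : ∃ F : ℕ → ℝ → EuclideanSpace ℝ (Fin n),
    (∀ j, ∃ K, LipschitzWith K (F j)) ∧
      Measure.hausdorffMeasure 1 (carrier \ ⋃ j, range (F j)) = 0
  locally_finite : IsLocallyFiniteMeasure
    (((Measure.hausdorffMeasure 1).restrict carrier).withDensity fun x => (mult x : ℝ≥0∞))

namespace IntegerRectifiableVarifold

variable {n : ℕ}

/-- The weight measure `μ_V = θ ℋ¹ ⌞ Γ` on `ℝⁿ`. -/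
noncomputable def weight (V : IntegerRectifiableVarifold n) :
    Measure (EuclideanSpace ℝ (Fin n)) :=
  ((Measure.hausdorffMeasure 1).restrict V.carrier).withDensity fun x => (V.mult x : ℝ≥0∞)

/-- The line `P` is the approximate tangent space of `Γ` at `x` with respect to `θ`: the rescalings
of `μ_V` around `x` converge to `θ(x) ℋ¹ ⌞ P`, tested against continuous functions with compact
support. -/
def IsApproxTangent (V : IntegerRectifiableVarifold n) (x : EuclideanSpace ℝ (Fin n))
    (P : Submodule ℝ (EuclideanSpace ℝ (Fin n))) : Prop :=
  Module.finrank ℝ P = 1 ∧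
    ∀ f : EuclideanSpace ℝ (Fin n) → ℝ, Continuous f → HasCompactSupport f →
      Tendsto (fun r : ℝ => r⁻¹ * ∫ y, f (r⁻¹ • (y - x)) ∂V.weight) (𝓝[>] 0)
        (𝓝 ((V.mult x : ℝ) *
          ∫ y in (P : Set (EuclideanSpace ℝ (Fin n))), f y ∂(Measure.hausdorffMeasure 1)))

open Classical in
/-- The approximate tangent line `T_xΓ`; it is unique at every point of `Γ` where it exists. At
points where there is none (a `μ_V`-null set) the value is the zero subspace. -/
noncomputable def tangent (V : IntegerRectifiableVarifold n) (x : EuclideanSpace ℝ (Fin n)) :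
    Submodule ℝ (EuclideanSpace ℝ (Fin n)) :=
  if h : ∃ P, V.IsApproxTangent x P then h.choose else ⊥

/-- The tangential divergence `div_{T_xΓ} X (x)`, the trace of `π_{T_xΓ} ∘ DX(x)`. -/
noncomputable def tangentialDiv (V : IntegerRectifiableVarifold n)
    (X : EuclideanSpace ℝ (Fin n) → EuclideanSpace ℝ (Fin n))
    (x : EuclideanSpace ℝ (Fin n)) : ℝ :=
  LinearMap.trace ℝ (EuclideanSpace ℝ (Fin n))
    ((V.tangent x).starProjection ∘L fderiv ℝ X x).toLinearMap

/-- `V` has generalized curvature vector `k ∈ L¹_loc(μ_V)` and no generalized boundary: the first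
variation formula `∫ div_{TΓ} X dμ_V = - ∫ ⟨X, k⟩ dμ_V` holds for all `X ∈ C¹_c(ℝⁿ; ℝⁿ)`. -/
def HasCurvatureNoBoundary (V : IntegerRectifiableVarifold n)
    (k : EuclideanSpace ℝ (Fin n) → EuclideanSpace ℝ (Fin n)) : Prop :=
  LocallyIntegrable k V.weight ∧
    ∀ X : EuclideanSpace ℝ (Fin n) → EuclideanSpace ℝ (Fin n),
      ContDiff ℝ 1 X → HasCompactSupport X →
        ∫ x, V.tangentialDiv X x ∂V.weight = - ∫ x, inner ℝ (X x) (k x) ∂V.weight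

/-- The energy `ℰ_p(V) = ∫ |k|^p dμ_V` of a varifold with generalized curvature `k`. -/
noncomputable def energy (V : IntegerRectifiableVarifold n)
    (k : EuclideanSpace ℝ (Fin n) → EuclideanSpace ℝ (Fin n)) (p : ℝ) : ℝ≥0∞ :=
  ∫⁻ x, ‖k x‖ₑ ^ p ∂V.weight

/-- The density of `μ_V` at `x` exists and equals `d`: `μ_V(B_r(x)) / (2r) → d` as `r ↘ 0`. -/
def HasDensity (V : IntegerRectifiableVarifold n) (x : EuclideanSpace ℝ (Fin n))
    (d : ℝ≥0∞) : Prop :=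
  Tendsto (fun r : ℝ => V.weight (Metric.ball x r) / ENNReal.ofReal (2 * r)) (𝓝[>] 0) (𝓝 d)

end IntegerRectifiableVarifold

/-!
The proof rests on the monotonicity inequality
`μ_V(B_σ(x₀)) / σ ≤ μ_V(B_ρ(x₀)) / ρ + ∫_{B_ρ(x₀)} |k_V| dμ_V` for `0 < σ < ρ`, which is
`HasCurvatureNoBoundary.weight_ball_div_le`. It follows by testing the first variation formula with
a smooth approximation of the radial field `X(x) = (1 / max(|x - x₀|, σ) - 1 / ρ)₊ (x - x₀)`: one has
`|X| ≤ 1`, and the tangential divergence of `X` is at least `1 / σ - 1 / ρ` on `B_σ(x₀)` and at least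
`-1 / ρ` on `B_ρ(x₀)`, because the projection of `x - x₀` to a line is no longer than `x - x₀`.

The inequality gives the comparison of `limsup` and `liminf` at once. Points are `μ_V`-null, so
letting `σ` and then `ρ` tend to `0` shows that the density `Θ(x)` exists at every point, and letting
`ρ → ∞` for finite total mass bounds `2 Θ(x)` by the energy `ℰ_1(V)`
(`HasCurvatureNoBoundary.tendsto_weight_ball_div`, `HasCurvatureNoBoundary.limsup_le_lintegral`). As
`Θ = θ_V ≥ 1` at `μ_V`-a.e. point, the lower bound `2 ≤ ℰ_1(V)` follows; its upper bound is Hölder's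
inequality.

It remains to know that the tangent space is a line at `μ_V`-a.e. point, that it depends measurably
on the point, and that the density is the multiplicity. Up to an `ℋ¹`-null set, `Γ` is a countable
union of Borel pieces with constant multiplicity which are `ε`-Lipschitz graphs over lines
(`LipschitzWith.exists_flat_cover_range`, via a one-dimensional Sard theorem). At a.e. point of such
a piece, Lebesgue's density theorem on the line describes the blow-up of the piece up to an error of
order `ε`, and the rest of `μ_V` has density zero there by a Vitali covering argument
(`hausdorffMeasure_one_eq_zero_of_frequently_le`). Letting `ε → 0` along a sequence whose directions
converge gives the approximate tangent line (`ae_exists_isApproxTangent`). Testing the blow-up with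
cutoffs of the unit ball identifies the density (`IsApproxTangent.density_eq`), and testing it with
quadratic forms exhibits the tangential projection as a limit of measurable functions
(`aemeasurable_norm_tangent_projection_sq`). Finally, `ℋ¹`-a.e. point off `Γ` has density zero, again
by the covering argument.
-/

/-! ### Sets of vanishing one-dimensional density -/

/-- A `ν`-null set all of whose points have positive upper one-dimensional `ν`-density is
`ℋ¹`-null. By Vitali's covering lemma it is covered by the fivefold enlargements of disjoint small
balls `B_r` with `c r ≤ ν(B_r)`, contained in an open set of small `ν`-measure. -/
theorem hausdorffMeasure_one_eq_zero_of_frequently_le {X : Type*} [MetricSpace X]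
    [MeasurableSpace X] [BorelSpace X] [TopologicalSpace.SeparableSpace X]
    (ν : Measure X) [ν.OuterRegular] {A : Set X} (hA : ν A = 0) {c : ℝ≥0∞} (hc : c ≠ 0)
    (hc' : c ≠ ⊤)
    (h : ∀ x ∈ A, ∃ᶠ r in 𝓝[>] (0 : ℝ), c * ENNReal.ofReal r ≤ ν (Metric.closedBall x r)) :
    Measure.hausdorffMeasure 1 A = 0 := by
  have key : ∀ m : ℕ, ∃ u : Set (X × ℝ), u.Countable ∧
      (∀ a ∈ u, 0 < a.2 ∧ a.2 ≤ 1 / ((m : ℝ) + 1)) ∧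
      A ⊆ ⋃ a : u, Metric.closedBall a.1.1 (5 * a.1.2) ∧
      ∑' a : u, ENNReal.ofReal a.1.2 ≤ c⁻¹ * ENNReal.ofReal (1 / ((m : ℝ) + 1)) := by
    intro m
    have hm : 0 < 1 / ((m : ℝ) + 1) := by positivity
    obtain ⟨U, hAU, hU, hνU⟩ := A.exists_isOpen_lt_of_lt (μ := ν)
      (ENNReal.ofReal (1 / ((m : ℝ) + 1))) (by rw [hA]; exact ENNReal.ofReal_pos.2 hm)
    let t : Set (X × ℝ) := {a | a.1 ∈ A ∧ 0 < a.2 ∧ a.2 ≤ 1 / ((m : ℝ) + 1) ∧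
      Metric.closedBall a.1 a.2 ⊆ U ∧ c * ENNReal.ofReal a.2 ≤ ν (Metric.closedBall a.1 a.2)}
    obtain ⟨u, hut, hdisj, hcov⟩ := Vitali.exists_disjoint_subfamily_covering_enlargement_closedBall
      t (fun a => a.1) (fun a => a.2) (1 / ((m : ℝ) + 1)) (fun a ha => ha.2.2.1) 5 (by norm_num)
    have hu : u.Countable := by
      refine hdisj.countable_of_nonempty_interior fun a ha => ⟨a.1, ?_⟩
      exact mem_interior_iff_mem_nhds.2 (Metric.closedBall_mem_nhds _ (hut ha).2.1)
    refine ⟨u, hu, fun a ha => ⟨(hut ha).2.1, (hut ha).2.2.1⟩, fun x hx => ?_, ?_⟩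
    · obtain ⟨δ, hδ, hδU⟩ := Metric.nhds_basis_closedBall.mem_iff.1 (hU.mem_nhds (hAU hx))
      have hev : ∀ᶠ r in 𝓝[>] (0 : ℝ), 0 < r ∧ r ≤ min δ (1 / ((m : ℝ) + 1)) := by
        filter_upwards [Ioc_mem_nhdsGT (lt_min hδ hm)] with r hr using hr
      obtain ⟨r, hr, hr0, hr1⟩ := ((h x hx).and_eventually hev).exists
      obtain ⟨b, hb, hxb⟩ := hcov (x, r) ⟨hx, hr0, hr1.trans (min_le_right _ _),
        (Metric.closedBall_subset_closedBall (hr1.trans (min_le_left _ _))).trans hδU, hr⟩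
      exact mem_iUnion.2 ⟨⟨b, hb⟩, hxb (Metric.mem_closedBall_self hr0.le)⟩
    · have : Countable u := hu.to_subtype
      have h1 : ∑' a : u, c * ENNReal.ofReal a.1.2 ≤ ν U := by
        calc ∑' a : u, c * ENNReal.ofReal a.1.2
            ≤ ∑' a : u, ν (Metric.closedBall a.1.1 a.1.2) :=
              ENNReal.tsum_le_tsum fun a => (hut a.2).2.2.2.2
          _ = ν (⋃ a : u, Metric.closedBall a.1.1 a.1.2) := by
              refine (measure_iUnion (fun a b hab => ?_) fun a => measurableSet_closedBall).symm
              exact hdisj a.2 b.2 (Subtype.coe_injective.ne hab)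
          _ ≤ ν U := measure_mono (iUnion_subset fun a => (hut a.2).2.2.2.1)
      rw [ENNReal.tsum_mul_left] at h1
      rw [← ENNReal.mul_le_iff_le_inv hc hc']
      exact h1.trans hνU.le
  choose u hu hur hcov hsum using key
  have : ∀ m, Countable (u m) := fun m => (hu m).to_subtype
  have hlim : Tendsto (fun m : ℕ => ENNReal.ofReal (1 / ((m : ℝ) + 1))) atTop (𝓝 0) := by
    simpa [Function.comp_def] using
      (ENNReal.continuous_ofReal.tendsto _).comp tendsto_one_div_add_atTop_nhds_zero_nat
  have hdiam : ∀ (m : ℕ) (a : u m), Metric.ediam (Metric.closedBall a.1.1 (5 * a.1.2)) ≤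
      10 * ENNReal.ofReal a.1.2 := by
    intro m a
    have h0 := (hur m a.1 a.2).1
    rw [← Metric.closedEBall_ofReal (by positivity)]
    refine Metric.ediam_closedEBall_le.trans (le_of_eq ?_)
    rw [ENNReal.ofReal_mul (by norm_num), ← mul_assoc]
    norm_num
  refine le_antisymm ?_ zero_le
  refine (Measure.hausdorffMeasure_le_liminf_tsum (β := ℕ) (ι := fun m => u m) (l := atTop) 1 A
    (fun m => 10 * ENNReal.ofReal (1 / ((m : ℝ) + 1))) ?_
    (fun m a => Metric.closedBall a.1.1 (5 * a.1.2)) ?_ ?_).trans ?_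
  · simpa using ENNReal.Tendsto.const_mul hlim (Or.inr (by norm_num : (10 : ℝ≥0∞) ≠ ⊤))
  · refine Eventually.of_forall fun m a => (hdiam m a).trans ?_
    gcongr
    exact (hur m a.1 a.2).2
  · exact Eventually.of_forall hcov
  · have h2 : Tendsto (fun m : ℕ => 10 * (c⁻¹ * ENNReal.ofReal (1 / ((m : ℝ) + 1)))) atTop
        (𝓝 0) := by
      have h3 := ENNReal.Tendsto.const_mul hlim (Or.inr (ENNReal.inv_ne_top.2 hc))
      rw [mul_zero] at h3
      simpa using ENNReal.Tendsto.const_mul h3 (Or.inr (by norm_num : (10 : ℝ≥0∞) ≠ ⊤))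
    rw [← h2.liminf_eq]
    refine liminf_le_liminf (Eventually.of_forall fun m => ?_)
    calc ∑' a : u m, Metric.ediam (Metric.closedBall a.1.1 (5 * a.1.2)) ^ (1 : ℝ)
        ≤ ∑' a : u m, 10 * ENNReal.ofReal a.1.2 :=
          ENNReal.tsum_le_tsum fun a => by rw [ENNReal.rpow_one]; exact hdiam m a
      _ = 10 * ∑' a : u m, ENNReal.ofReal a.1.2 := ENNReal.tsum_mul_left
      _ ≤ _ := by gcongr; exact hsum m

/-- A measure vanishing on `A` has zero one-dimensional density at `ℋ¹`-a.e. point of `A`. -/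
theorem hausdorffMeasure_one_not_tendsto_div_zero {X : Type*} [MetricSpace X]
    [MeasurableSpace X] [BorelSpace X] [TopologicalSpace.SeparableSpace X]
    (ν : Measure X) [ν.OuterRegular] {A : Set X} (hA : ν A = 0) :
    Measure.hausdorffMeasure 1 {x ∈ A | ¬ Tendsto
      (fun r => ν (Metric.closedBall x r) / ENNReal.ofReal r) (𝓝[>] (0 : ℝ)) (𝓝 0)} = 0 := by
  have hj : ∀ j : ℕ, Measure.hausdorffMeasure 1 {x ∈ A | ∃ᶠ r in 𝓝[>] (0 : ℝ),
      ((j : ℝ≥0∞) + 1)⁻¹ * ENNReal.ofReal r ≤ ν (Metric.closedBall x r)} = 0 := fun j =>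
    hausdorffMeasure_one_eq_zero_of_frequently_le ν (measure_mono_null (sep_subset _ _) hA)
      (ENNReal.inv_ne_zero.2 (by finiteness)) (ENNReal.inv_ne_top.2 (by simp)) fun x hx => hx.2
  refine measure_mono_null (fun x hx => ?_) (measure_iUnion_null hj)
  by_contra hcon
  simp only [mem_iUnion, mem_ofPred_eq, not_exists, not_and, not_frequently, not_le] at hcon
  refine hx.2 (ENNReal.tendsto_nhds_zero.2 fun ε hε => ?_)
  obtain ⟨j, hjε⟩ := ENNReal.exists_inv_nat_lt hε.ne'
  filter_upwards [hcon j hx.1, self_mem_nhdsWithin] with r hr (hr0 : 0 < r)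
  refine ENNReal.div_le_of_le_mul (hr.le.trans ?_)
  gcongr
  exact (ENNReal.inv_le_inv.2 le_self_add).trans hjε.le

/-! ### Flat pieces of Lipschitz curves -/

/-- Sard's theorem for curves: the image of the critical points is `ℋ¹`-null, since there the curve
is locally Lipschitz with arbitrarily small constant. -/
theorem hausdorffMeasure_one_image_eq_zero_of_hasDerivAt_zero {E : Type*} [NormedAddCommGroup E]
    [NormedSpace ℝ E] [FiniteDimensional ℝ E] [MeasurableSpace E] [BorelSpace E]
    {F : ℝ → E} {s : Set ℝ} (h : ∀ t ∈ s, HasDerivAt F 0 t) :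
    Measure.hausdorffMeasure 1 (F '' s) = 0 := by
  have bounded : ∀ s : Set ℝ, (∀ t ∈ s, HasDerivAt F 0 t) → volume s ≠ ⊤ →
      Measure.hausdorffMeasure 1 (F '' s) = 0 := by
    intro s h hs
    have hle : ∀ ε : NNReal, ε ≠ 0 → Measure.hausdorffMeasure 1 (F '' s) ≤ ε * volume s := by
      intro ε hε
      obtain ⟨t, A, hdisj, htm, hst, happ, hA⟩ :=
        exists_partition_approximatesLinearOn_of_hasFDerivWithinAt F s (fun _ => 0)
          (fun x hx => by
            have := (h x hx).hasFDerivAt.hasFDerivWithinAt (s := s)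
            simpa using this) (fun _ => ε) (fun _ => hε)
      have hpiece : ∀ n, Measure.hausdorffMeasure 1 (F '' (s ∩ t n)) ≤
          ε * volume (s ∩ t n) := by
        intro n
        have hL : LipschitzOnWith ε F (s ∩ t n) := by
          refine LipschitzOnWith.of_dist_le_mul fun x hx y hy => ?_
          have hA0 : A n = 0 := by
            obtain ⟨_, _, h0⟩ := hA ⟨x, hx.1⟩ n
            exact h0
          have := happ n x hx y hy
          rw [hA0] at this
          simpa [dist_eq_norm] using this
        have := hL.hausdorffMeasure_image_le (d := 1) zero_le_one
        rwa [ENNReal.rpow_one, hausdorffMeasure_real] at this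
      calc Measure.hausdorffMeasure 1 (F '' s)
          ≤ Measure.hausdorffMeasure 1 (⋃ n, F '' (s ∩ t n)) := by
            rw [← image_iUnion, ← inter_iUnion, inter_eq_left.2 hst]
        _ ≤ ∑' n, Measure.hausdorffMeasure 1 (F '' (s ∩ t n)) := measure_iUnion_le _
        _ ≤ ∑' n, ε * volume (s ∩ t n) := ENNReal.tsum_le_tsum hpiece
        _ = ε * ∑' n, volume.restrict s (t n) := by
            rw [ENNReal.tsum_mul_left]
            congr 2 with n
            rw [Measure.restrict_apply (htm n), inter_comm]
        _ ≤ ε * volume s := by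
            rw [← measure_iUnion hdisj htm]
            have h0 := measure_mono (μ := volume.restrict s) (subset_univ (⋃ n, t n))
            rw [Measure.restrict_apply_univ] at h0
            gcongr
    refine le_antisymm (ge_of_tendsto' (x := atTop)
      (f := fun m : ℕ => (((1 / ((m : NNReal) + 1) : NNReal)) : ℝ≥0∞) * volume s) ?_
      fun m => hle _ (one_div_ne_zero (Nat.cast_add_one_ne_zero m))) zero_le
    have h0 : Tendsto (fun m : ℕ => (((1 / ((m : NNReal) + 1) : NNReal)) : ℝ≥0∞)) atTop (𝓝 0) := by
      rw [← ENNReal.coe_zero, ENNReal.tendsto_coe]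
      exact tendsto_one_div_add_atTop_nhds_zero_nat
    simpa using ENNReal.Tendsto.mul_const h0 (Or.inr hs)
  have hs : s = ⋃ N : ℕ, s ∩ Metric.closedBall 0 N := by
    rw [← inter_iUnion, Metric.iUnion_closedBall_nat, inter_univ]
  rw [hs, image_iUnion, measure_iUnion_null_iff]
  exact fun N => bounded _ (fun t ht => h t ht.1)
    (measure_ne_top_of_subset inter_subset_right measure_closedBall_lt_top.ne)

/-- `S` is contained in the closed double cone of slope `ε` around the line `y + ℝ v`, for each
of its points `y`. For a unit vector `v` this says that `S` is an `ε`-Lipschitz graph over a subset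
of the line `ℝ v`. -/
def IsFlatAlong {E : Type*} [NormedAddCommGroup E] [InnerProductSpace ℝ E]
    (ε : ℝ) (v : E) (S : Set E) : Prop :=
  ∀ y ∈ S, ∀ z ∈ S, ‖(z - y) - inner ℝ v (z - y) • v‖ ≤ ε * |inner ℝ v (z - y)|

theorem IsFlatAlong.mono {E : Type*} [NormedAddCommGroup E] [InnerProductSpace ℝ E]
    {ε : ℝ} {v : E} {S T : Set E} (h : IsFlatAlong ε v S) (hT : T ⊆ S) : IsFlatAlong ε v T :=
  fun y hy z hz => h y (hT hy) z (hT hz)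

theorem isFlatAlong_closure {E : Type*} [NormedAddCommGroup E] [InnerProductSpace ℝ E]
    {ε : ℝ} {v : E} {S : Set E} (h : IsFlatAlong ε v S) : IsFlatAlong ε v (closure S) := by
  have hc : IsClosed {p : E × E | ‖(p.2 - p.1) - inner ℝ v (p.2 - p.1) • v‖ ≤
      ε * |inner ℝ v (p.2 - p.1)|} := isClosed_le (by fun_prop) (by fun_prop)
  have hS : closure (S ×ˢ S) ⊆ {p : E × E | ‖(p.2 - p.1) - inner ℝ v (p.2 - p.1) • v‖ ≤
      ε * |inner ℝ v (p.2 - p.1)|} :=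
    closure_minimal (fun p hp => h p.1 hp.1 p.2 hp.2) hc
  intro y hy z hz
  have : (y, z) ∈ closure (S ×ˢ S) := by
    rw [closure_prod_eq]; exact ⟨hy, hz⟩
  exact hS this

/-- If `F` differs from `t ↦ t w` by at most `η |w|` times the increment of the parameter, its chords
have slope at most `η / (1 - η) ≤ 2 η` relative to `w`. -/
theorem ApproximatesLinearOn.isFlatAlong_image {E : Type*} [NormedAddCommGroup E]
    [InnerProductSpace ℝ E] {F : ℝ → E} {w : E} (hw : w ≠ 0) {η : ℝ} (hη : 0 < η)
    (hη2 : η ≤ 1 / 2) {T : Set ℝ} {c : NNReal} (hc : (c : ℝ) = η * ‖w‖)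
    (h : ApproximatesLinearOn F (ContinuousLinearMap.toSpanSingleton ℝ w) T c) :
    IsFlatAlong (2 * η) (‖w‖⁻¹ • w) (F '' T) := by
  rintro _ ⟨s, hs, rfl⟩ _ ⟨t, ht, rfl⟩
  have hw0 : 0 < ‖w‖ := norm_pos_iff.2 hw
  set v : E := ‖w‖⁻¹ • w with hv
  have hv1 : ‖v‖ = 1 := by rw [hv, norm_smul, norm_inv, norm_norm, inv_mul_cancel₀ hw0.ne']
  have hvv : inner ℝ v v = 1 := by rw [real_inner_self_eq_norm_sq, hv1, one_pow]
  have hwv : w = ‖w‖ • v := by rw [hv, smul_smul, mul_inv_cancel₀ hw0.ne', one_smul]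
  have h1 := h t ht s hs
  set e : E := F t - F s - (t - s) • w with he
  have hde : F t - F s = ((t - s) * ‖w‖) • v + e := by
    rw [he, mul_smul, ← hwv]; abel
  have h2 : ‖e‖ ≤ η * ‖w‖ * |t - s| := by
    simpa [hc, he, Real.norm_eq_abs] using h1
  rw [hde]
  have hin : inner ℝ v (((t - s) * ‖w‖) • v + e) = (t - s) * ‖w‖ + inner ℝ v e := by
    rw [inner_add_right, inner_smul_right, hvv, mul_one]
  rw [hin]
  have hie : |inner ℝ v e| ≤ ‖e‖ := by simpa [hv1] using abs_real_inner_le_norm v e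
  have hperp : ‖e - inner ℝ v e • v‖ ≤ ‖e‖ := by
    have : ‖e - inner ℝ v e • v‖ ^ 2 ≤ ‖e‖ ^ 2 := by
      rw [norm_sub_sq_real, norm_smul, hv1, inner_smul_right, real_inner_comm, Real.norm_eq_abs,
        mul_one, sq_abs]
      nlinarith [sq_nonneg (inner ℝ v e)]
    exact (pow_le_pow_iff_left₀ (norm_nonneg _) (norm_nonneg _) two_ne_zero).1 this
  have heq : ((t - s) * ‖w‖) • v + e - ((t - s) * ‖w‖ + inner ℝ v e) • v =
      e - inner ℝ v e • v := by
    rw [add_smul]; abel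
  rw [heq]
  have h3 : |t - s| * ‖w‖ - ‖e‖ ≤ |(t - s) * ‖w‖ + inner ℝ v e| := by
    have h4 := abs_sub_abs_le_abs_add ((t - s) * ‖w‖) (inner ℝ v e)
    rw [abs_mul, abs_norm] at h4
    linarith
  have h5 : 0 ≤ ‖w‖ * |t - s| := by positivity
  have h6 : ‖w‖ * |t - s| / 2 ≤ |(t - s) * ‖w‖ + inner ℝ v e| := by nlinarith
  nlinarith [mul_le_mul_of_nonneg_left h6 hη.le]

/-- A Lipschitz curve is covered, up to an `ℋ¹`-null set, by countably many closed `ε`-flat sets: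
closures of images of sets of parameters on which the curve is close to a fixed nonconstant affine
map. -/
theorem LipschitzWith.exists_flat_cover_range {E : Type*} [NormedAddCommGroup E]
    [InnerProductSpace ℝ E] [FiniteDimensional ℝ E] [MeasurableSpace E] [BorelSpace E]
    {F : ℝ → E} {C : NNReal} (hF : LipschitzWith C F) {ε : ℝ} (hε : 0 < ε) :
    ∃ 𝒮 : Set (Set E), 𝒮.Countable ∧
      (∀ S ∈ 𝒮, IsClosed S ∧ ∃ v : E, ‖v‖ = 1 ∧ IsFlatAlong ε v S) ∧
      Measure.hausdorffMeasure 1 (range F \ ⋃₀ 𝒮) = 0 := by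
  set s : Set ℝ := {t | DifferentiableAt ℝ F t ∧ deriv F t ≠ 0} with hs
  have hη : 0 < min (ε / 2) (1 / 2) := by positivity
  have hcover : ∃ 𝒮 : Set (Set E), 𝒮.Countable ∧
      (∀ S ∈ 𝒮, IsClosed S ∧ ∃ v : E, ‖v‖ = 1 ∧ IsFlatAlong ε v S) ∧ F '' s ⊆ ⋃₀ 𝒮 := by
    rcases s.eq_empty_or_nonempty with h0 | hne
    · exact ⟨∅, countable_empty, by simp, by simp [h0]⟩
    classical
    obtain ⟨t, A, -, hst, happ, hA⟩ :=
      exists_closed_cover_approximatesLinearOn_of_hasFDerivWithinAt F s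
        (fun t => ContinuousLinearMap.toSpanSingleton ℝ (deriv F t))
        (fun t ht => ht.1.hasDerivAt.hasFDerivAt.hasFDerivWithinAt)
        (fun A => if A = 0 then 1 else (min (ε / 2) (1 / 2)).toNNReal * ‖A‖₊)
        (fun A => by
          split_ifs with h
          · exact one_ne_zero
          · refine mul_ne_zero (Real.toNNReal_pos.2 hη).ne' (by simpa using h))
    refine ⟨range fun n => closure (F '' (s ∩ t n)), countable_range _, ?_, ?_⟩
    · rintro _ ⟨n, rfl⟩
      refine ⟨isClosed_closure, ?_⟩
      obtain ⟨y, hy, hAy⟩ := hA hne n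
      have hw := hy.2
      have hA0 : A n ≠ 0 := by
        rw [hAy]
        intro h
        have := congrArg (fun L : ℝ →L[ℝ] E => L 1) h
        exact hw (by simpa using this)
      have := happ n
      rw [if_neg hA0, hAy] at this
      have hflat := this.isFlatAlong_image hw hη (min_le_right _ _)
        (by rw [NNReal.coe_mul, coe_nnnorm, ContinuousLinearMap.norm_toSpanSingleton,
          Real.coe_toNNReal _ hη.le])
      refine ⟨‖deriv F y‖⁻¹ • deriv F y, ?_, isFlatAlong_closure fun a ha b hb =>
        (hflat a ha b hb).trans ?_⟩
      · rw [norm_smul, norm_inv, norm_norm, inv_mul_cancel₀ (norm_ne_zero_iff.2 hw)]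
      · gcongr
        linarith [min_le_left (ε / 2) (1 / 2 : ℝ)]
    · rintro _ ⟨a, ha, rfl⟩
      obtain ⟨n, hn⟩ := mem_iUnion.1 (hst ha)
      exact mem_sUnion.2 ⟨_, ⟨n, rfl⟩, subset_closure ⟨a, ⟨ha, hn⟩, rfl⟩⟩
  obtain ⟨𝒮, h1, h2, h3⟩ := hcover
  refine ⟨𝒮, h1, h2, ?_⟩
  have hsub : range F \ ⋃₀ 𝒮 ⊆ F '' {t | ¬ DifferentiableAt ℝ F t} ∪
      F '' {t | HasDerivAt F 0 t} := by
    rintro _ ⟨⟨t, rfl⟩, ht⟩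
    by_cases hd : DifferentiableAt ℝ F t
    · by_cases h0 : deriv F t = 0
      · exact Or.inr ⟨t, by simpa [h0] using hd.hasDerivAt, rfl⟩
      · exact absurd (h3 ⟨t, ⟨hd, h0⟩, rfl⟩) ht
    · exact Or.inl ⟨t, hd, rfl⟩
  refine measure_mono_null hsub (measure_union_null ?_
    (hausdorffMeasure_one_image_eq_zero_of_hasDerivAt_zero fun t ht => ht))
  have h4 := (hF.lipschitzOnWith (s := {t | ¬ DifferentiableAt ℝ F t})).hausdorffMeasure_image_le
    (d := 1) zero_le_one
  rw [hausdorffMeasure_real, ae_iff.1 (hF.ae_differentiableAt (μ := volume)), mul_zero] at h4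
  exact le_antisymm h4 zero_le

/-! ### Blow-ups of flat pieces -/

section Flat

variable {E : Type*} [NormedAddCommGroup E] [InnerProductSpace ℝ E]

theorem IsFlatAlong.norm_sub_le {ε : ℝ} {v : E} (hv : ‖v‖ = 1) {S : Set E}
    (h : IsFlatAlong ε v S) {y z : E} (hy : y ∈ S) (hz : z ∈ S) :
    ‖z - y‖ ≤ (1 + ε) * |inner ℝ v z - inner ℝ v y| := by
  have h1 := h y hy z hz
  have h2 := norm_le_norm_sub_add (z - y) (inner ℝ v (z - y) • v)
  rw [norm_smul, hv, mul_one, Real.norm_eq_abs] at h2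
  rw [← inner_sub_right]
  linarith

theorem lipschitzWith_inner_left {v : E} (hv : ‖v‖ = 1) :
    LipschitzWith 1 fun y : E => inner ℝ v y :=
  LipschitzWith.of_dist_le_mul fun y z => by
    rw [Real.dist_eq, ← inner_sub_right, dist_eq_norm, NNReal.coe_one, ← hv]
    exact abs_real_inner_le_norm _ _

theorem IsFlatAlong.injOn {ε : ℝ} {v : E} (hv : ‖v‖ = 1) {K : Set E}
    (h : IsFlatAlong ε v K) : InjOn (fun y => inner ℝ v y) K := by
  intro y hy z hz hyz
  have := h.norm_sub_le hv hz hy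
  rw [show inner ℝ v y = inner ℝ v z from hyz, sub_self, abs_zero, mul_zero] at this
  exact sub_eq_zero.1 (norm_le_zero_iff.1 this)

variable [MeasurableSpace E] [BorelSpace E]

theorem volume_inter_le_hausdorffMeasure {v : E} (hv : ‖v‖ = 1) (K : Set E) (B : Set ℝ) :
    volume ((fun y => inner ℝ v y) '' K ∩ B) ≤
      Measure.hausdorffMeasure 1 (K ∩ (fun y => inner ℝ v y) ⁻¹' B) := by
  rw [← image_inter_preimage]
  have := ((lipschitzWith_inner_left hv).lipschitzOnWith
    (s := K ∩ (fun y => inner ℝ v y) ⁻¹' B)).hausdorffMeasure_image_le (d := 1) zero_le_one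
  simpa [hausdorffMeasure_real] using this

theorem IsFlatAlong.hausdorffMeasure_le {ε : ℝ} (hε : 0 ≤ ε) {v : E} (hv : ‖v‖ = 1) {K : Set E}
    (h : IsFlatAlong ε v K) (B : Set ℝ) :
    Measure.hausdorffMeasure 1 (K ∩ (fun y => inner ℝ v y) ⁻¹' B) ≤
      ENNReal.ofReal (1 + ε) * volume ((fun y => inner ℝ v y) '' K ∩ B) := by
  set π : E → ℝ := fun y => inner ℝ v y
  have hL : AntilipschitzWith (1 + ε).toNNReal (K.domRestrict π) := by
    refine AntilipschitzWith.of_le_mul_dist fun y z => ?_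
    rw [Subtype.dist_eq, dist_eq_norm, Real.coe_toNNReal _ (by linarith), Real.dist_eq]
    exact h.norm_sub_le hv z.2 y.2
  have h1 := hL.hausdorffMeasure_preimage_le (d := 1) zero_le_one (π '' K ∩ B)
  have h2 := (isometry_subtype_coe (s := K)).hausdorffMeasure_image (d := 1)
    (Or.inl zero_le_one) (K.domRestrict π ⁻¹' (π '' K ∩ B))
  have h3 : (Subtype.val '' (K.domRestrict π ⁻¹' (π '' K ∩ B)) : Set E) = K ∩ π ⁻¹' B := by
    ext y
    constructor
    · rintro ⟨z, hz, rfl⟩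
      exact ⟨z.2, hz.2⟩
    · rintro ⟨hy, hB⟩
      exact ⟨⟨y, hy⟩, ⟨⟨y, hy, rfl⟩, hB⟩, rfl⟩
  rw [← h3, h2]
  rw [ENNReal.rpow_one, hausdorffMeasure_real] at h1
  exact h1

variable [FiniteDimensional ℝ E]

theorem IsFlatAlong.measurableSet_image {ε : ℝ} {v : E} (hv : ‖v‖ = 1) {K : Set E}
    (h : IsFlatAlong ε v K) (hK : MeasurableSet K) :
    MeasurableSet ((fun y => inner ℝ v y) '' K) :=
  have := FiniteDimensional.proper_real E
  hK.image_of_continuousOn_injOn (by fun_prop) (h.injOn hv)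

/-- Lebesgue's density theorem for the projection of a flat set. -/
theorem IsFlatAlong.hausdorffMeasure_not_density_point {ε : ℝ} (hε : 0 ≤ ε) {v : E} (hv : ‖v‖ = 1)
    {K : Set E} (h : IsFlatAlong ε v K) (hK : MeasurableSet K) :
    Measure.hausdorffMeasure 1 {x ∈ K | ¬ Tendsto (fun r => volume ((fun y => inner ℝ v y) '' K ∩
      Metric.closedBall (inner ℝ v x) r) / volume (Metric.closedBall (inner ℝ v x) r))
      (𝓝[>] 0) (𝓝 1)} = 0 := by
  have h1 := Besicovitch.ae_tendsto_measure_inter_div volume ((fun y => inner ℝ v y) '' K)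
  rw [ae_restrict_iff' (h.measurableSet_image hv hK), ae_iff] at h1
  set N : Set ℝ := {a | ¬(a ∈ (fun y => inner ℝ v y) '' K → Tendsto
    (fun r => volume ((fun y => inner ℝ v y) '' K ∩ Metric.closedBall a r) /
      volume (Metric.closedBall a r)) (𝓝[>] 0) (𝓝 1))} with hN
  have h2 := (h.hausdorffMeasure_le hε hv N).trans
    (mul_le_mul_right (measure_mono inter_subset_right) _)
  rw [h1, mul_zero] at h2
  refine measure_mono_null (fun x hx => ?_) (le_antisymm h2 zero_le)
  exact ⟨hx.1, fun h' => hx.2 (h' ⟨x, hx.1, rfl⟩)⟩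

end Flat

theorem tendsto_nhdsGT_scale {c : ℝ} (hc : 0 < c) :
    Tendsto (fun r : ℝ => c * r) (𝓝[>] 0) (𝓝[>] 0) := by
  refine tendsto_nhdsWithin_iff.2 ⟨?_, ?_⟩
  · have : Tendsto (fun r : ℝ => c * r) (𝓝 0) (𝓝 (c * 0)) :=
      (continuous_const.mul continuous_id).tendsto _
    rw [mul_zero] at this
    exact this.mono_left nhdsWithin_le_nhds
  · filter_upwards [self_mem_nhdsWithin] with r hr using mul_pos hc hr

theorem abs_integral_sub_integral_le_of_le {α : Type*} [MeasurableSpace α] {μ ν : Measure α}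
    [IsFiniteMeasure μ] [IsFiniteMeasure ν] (hle : μ ≤ ν) {h : α → ℝ} {M : ℝ}
    (hM : ∀ a, ‖h a‖ ≤ M) (hm : AEStronglyMeasurable h ν) :
    |∫ a, h a ∂ν - ∫ a, h a ∂μ| ≤ M * (ν.real univ - μ.real univ) := by
  have hsum : ν - μ + μ = ν := Measure.sub_add_cancel_of_le hle
  have hsub : ν - μ ≤ ν := Measure.sub_le
  have hi : Integrable h ν := Integrable.of_bound hm M (Eventually.of_forall hM)
  have h1 : ∫ a, h a ∂ν = ∫ a, h a ∂(ν - μ) + ∫ a, h a ∂μ := by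
    conv_lhs => rw [← hsum]
    exact integral_add_measure (hi.mono_measure hsub) (hi.mono_measure hle)
  have h2 : ν.real univ = (ν - μ).real univ + μ.real univ := by
    conv_lhs => rw [← hsum]
    exact measureReal_add_apply
  rw [h1, h2, add_sub_cancel_right, add_sub_cancel_right]
  exact norm_integral_le_of_norm_le_const (Eventually.of_forall hM)

theorem integral_line_rescale {E : Type*} [NormedAddCommGroup E] [NormedSpace ℝ E]
    (v : E) (f : E → ℝ) (t₀ : ℝ) {r : ℝ} (hr : 0 < r) :
    ∫ t : ℝ, f ((r⁻¹ * (t - t₀)) • v) = r * ∫ s : ℝ, f (s • v) := by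
  rw [integral_sub_right_eq_self (fun t => f ((r⁻¹ * t) • v)) t₀,
    Measure.integral_comp_mul_left (fun s => f (s • v)), inv_inv, abs_of_pos hr, smul_eq_mul]

section Blowup

variable {E : Type*} [NormedAddCommGroup E] [InnerProductSpace ℝ E] [FiniteDimensional ℝ E]
  [MeasurableSpace E] [BorelSpace E]

/-- The rescalings of `ℋ¹ ⌞ K` around a point `x` of an `ε`-flat set `K`, whose projection to `ℝ v`
has density `1` at the projection of `x`, are close to `ℋ¹ ⌞ ℝ v`, when tested with a function `f`
supported in `B_R(0)`, bounded by `M`, and with oscillation at most `ω` at scale `ε R`. Projecting to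
`ℝ v` moves the rescaled points by at most `ε R`, and the projected measure lies between Lebesgue
measure and `1 + ε` times Lebesgue measure on the projection of `K`. -/
theorem IsFlatAlong.eventually_abs_blowup_sub_le {ε : ℝ} (hε : 0 ≤ ε) {v : E} (hv : ‖v‖ = 1)
    {K : Set E} (h : IsFlatAlong ε v K) (hK : MeasurableSet K) {x : E} (hx : x ∈ K)
    (hd : Tendsto (fun r => volume ((fun y => inner ℝ v y) '' K ∩
      Metric.closedBall (inner ℝ v x) r) / volume (Metric.closedBall (inner ℝ v x) r))
      (𝓝[>] 0) (𝓝 1))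
    {f : E → ℝ} (hf : Continuous f) {R M ω : ℝ} (hR : 0 < R) (hfR : ∀ a, R < ‖a‖ → f a = 0)
    (hM : ∀ a, |f a| ≤ M) (hω : ∀ a b, ‖a - b‖ ≤ ε * R → |f a - f b| ≤ ω) {δ : ℝ} (hδ : 0 < δ) :
    ∀ᶠ r in 𝓝[>] (0 : ℝ),
      |r⁻¹ * ∫ y in K, f (r⁻¹ • (y - x)) ∂(Measure.hausdorffMeasure 1) - ∫ s : ℝ, f (s • v)| ≤
        2 * R * ((1 + ε) * ω + ε * M) + δ := by
  have hM0 : 0 ≤ M := (abs_nonneg _).trans (hM 0)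
  have hω0 : 0 ≤ ω := (abs_nonneg _).trans (hω 0 0 (by simpa using by positivity))
  set π : E → ℝ := fun y => inner ℝ v y with hπ
  have hπc : Continuous π := by fun_prop
  have hδ' : 0 < δ / (2 * R * (M + 1)) := by positivity
  set δ' := δ / (2 * R * (M + 1)) with hδ'def
  have hd' := (hd.comp (tendsto_nhdsGT_scale hR)).eventually
    (lt_mem_nhds (ENNReal.ofReal_lt_one.2 (by linarith : 1 - δ' < 1)))
  filter_upwards [hd', self_mem_nhdsWithin] with r hr (hr0 : 0 < r)
  set I : Set ℝ := Metric.closedBall (π x) (R * r) with hI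
  have hIm : MeasurableSet I := measurableSet_closedBall
  have hvolI : volume I = ENNReal.ofReal (2 * (R * r)) := Real.volume_closedBall _ _
  have hvolIr : volume.real I = 2 * (R * r) := by
    rw [measureReal_def, hvolI, ENNReal.toReal_ofReal (by positivity)]
  set ρ : Measure E := (Measure.hausdorffMeasure 1).restrict (K ∩ π ⁻¹' I) with hρ
  set ν : Measure ℝ := ρ.map π with hν
  set lam : Measure ℝ := volume.restrict (π '' K ∩ I) with hlam
  have hK' : MeasurableSet (π '' K) := h.measurableSet_image hv hK
  have hρle : ρ univ ≤ ENNReal.ofReal (1 + ε) * lam univ := by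
    rw [hρ, hlam, Measure.restrict_apply_univ, Measure.restrict_apply_univ]
    exact h.hausdorffMeasure_le hε hv I
  have hlamI : lam univ ≤ volume I := by
    rw [hlam, Measure.restrict_apply_univ]; exact measure_mono inter_subset_right
  have : IsFiniteMeasure lam := ⟨hlamI.trans_lt measure_closedBall_lt_top⟩
  have : IsFiniteMeasure ρ :=
    ⟨hρle.trans_lt (ENNReal.mul_lt_top ENNReal.ofReal_lt_top (measure_lt_top _ _))⟩
  have : IsFiniteMeasure (volume.restrict I) :=
    ⟨by rw [Measure.restrict_apply_univ]; exact measure_closedBall_lt_top⟩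
  have : IsFiniteMeasure ν := by rw [hν]; infer_instance
  have hνuniv : ν.real univ = ρ.real univ := by
    rw [measureReal_def, measureReal_def, hν, Measure.map_apply hπc.measurable .univ, preimage_univ]
  have hlamr : lam.real univ ≤ 2 * (R * r) := by
    rw [← hvolIr]; exact ENNReal.toReal_mono measure_closedBall_lt_top.ne hlamI
  have hρr : ρ.real univ ≤ (1 + ε) * lam.real univ := by
    have := ENNReal.toReal_mono (ENNReal.mul_ne_top ENNReal.ofReal_ne_top
      (measure_ne_top lam univ)) hρle
    rwa [ENNReal.toReal_mul, ENNReal.toReal_ofReal (by linarith)] at this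
  have hlamν : lam ≤ ν := by
    refine Measure.le_iff.2 fun B hB => ?_
    rw [hν, Measure.map_apply hπc.measurable hB, hρ, hlam, Measure.restrict_apply hB,
      Measure.restrict_apply (hπc.measurable hB), inter_comm B, inter_assoc,
      inter_comm (π ⁻¹' B), inter_assoc, ← preimage_inter]
    exact volume_inter_le_hausdorffMeasure hv K (I ∩ B)
  have hlamle : lam ≤ volume.restrict I := Measure.restrict_mono inter_subset_right le_rfl
  have hdens : (1 - δ') * (2 * (R * r)) ≤ lam.real univ := by
    have h1 : ENNReal.ofReal (1 - δ') < volume (π '' K ∩ I) / volume I := hr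
    have h2 := (ENNReal.lt_div_iff_mul_lt (Or.inl (by rw [hvolI]; simp; positivity))
      (Or.inl measure_closedBall_lt_top.ne)).1 h1
    have h3 := ENNReal.toReal_mono (measure_ne_top lam univ)
      (h2.le.trans_eq (Measure.restrict_apply_univ _).symm)
    rw [ENNReal.toReal_mul, ← measureReal_def, hvolIr, ENNReal.toReal_ofReal'] at h3
    refine (mul_le_mul_of_nonneg_right (le_max_left _ _) (by positivity)).trans h3
  -- the rescaled test function on the line
  set g : ℝ → ℝ := fun t => f ((r⁻¹ * (t - π x)) • v) with hg
  have hgc : Continuous g := by fun_prop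
  have hg0 : ∀ t, t ∉ I → g t = 0 := by
    intro t ht
    rw [hI, Metric.mem_closedBall, not_le, Real.dist_eq] at ht
    refine hfR _ ?_
    rw [norm_smul, hv, mul_one, Real.norm_eq_abs, abs_mul, abs_of_pos (inv_pos.2 hr0),
      ← div_eq_inv_mul, lt_div_iff₀ hr0]
    exact ht
  have hfI : ∀ y, π y ∉ I → f (r⁻¹ • (y - x)) = 0 := by
    intro y hy
    rw [hI, Metric.mem_closedBall, not_le, Real.dist_eq] at hy
    refine hfR _ ?_
    rw [norm_smul, Real.norm_eq_abs, abs_of_pos (inv_pos.2 hr0), ← div_eq_inv_mul,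
      lt_div_iff₀ hr0]
    refine hy.trans_le ?_
    rw [hπ, ← inner_sub_right]
    simpa [hv] using abs_real_inner_le_norm v (y - x)
  have hint1 : ∫ y in K, f (r⁻¹ • (y - x)) ∂(Measure.hausdorffMeasure 1) =
      ∫ y, f (r⁻¹ • (y - x)) ∂ρ :=
    setIntegral_eq_of_subset_of_forall_sdiff_eq_zero hK inter_subset_left
      fun y hy => hfI y fun h' => hy.2 ⟨hy.1, h'⟩
  have hint2 : ∫ y, g (π y) ∂ρ = ∫ t, g t ∂ν :=
    (integral_map hπc.aemeasurable hgc.aestronglyMeasurable).symm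
  have hint3 : ∫ t in I, g t = r * ∫ s : ℝ, f (s • v) := by
    rw [← integral_line_rescale v f (π x) hr0]
    exact setIntegral_eq_integral_of_forall_compl_eq_zero fun t ht => hg0 t ht
  -- replacing the points of `K` by their projections
  have e1 : |∫ y, f (r⁻¹ • (y - x)) ∂ρ - ∫ y, g (π y) ∂ρ| ≤ ω * ρ.real univ := by
    have hi1 : Integrable (fun y => f (r⁻¹ • (y - x))) ρ :=
      Integrable.of_bound (by fun_prop) M (Eventually.of_forall fun y => hM _)
    have hi2 : Integrable (fun y => g (π y)) ρ :=
      Integrable.of_bound (by fun_prop) M (Eventually.of_forall fun y => hM _)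
    rw [← integral_sub hi1 hi2, ← Real.norm_eq_abs]
    have hmem : ∀ᵐ y ∂ρ, y ∈ K ∩ π ⁻¹' I := ae_restrict_mem (hK.inter (hπc.measurable hIm))
    refine norm_integral_le_of_norm_le_const (hmem.mono fun y hy => ?_)
    refine hω _ _ ?_
    have h1 : r⁻¹ • (y - x) - (r⁻¹ * (π y - π x)) • v =
        r⁻¹ • ((y - x) - inner ℝ v (y - x) • v) := by
      rw [mul_smul, ← smul_sub, inner_sub_right]
    rw [h1, norm_smul, Real.norm_eq_abs, abs_of_pos (inv_pos.2 hr0), ← div_eq_inv_mul,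
      div_le_iff₀ hr0]
    refine (h x hx y hy.1).trans ?_
    rw [mul_assoc]
    refine mul_le_mul_of_nonneg_left ?_ hε
    have := hy.2
    rwa [mem_preimage, hI, Metric.mem_closedBall, Real.dist_eq, hπ, ← inner_sub_right] at this
  -- replacing the projected measure by Lebesgue measure, first on the projection of `K`
  have e2 := abs_integral_sub_integral_le_of_le hlamν (fun t => hM ((r⁻¹ * (t - π x)) • v))
    hgc.aestronglyMeasurable
  have e3 := abs_integral_sub_integral_le_of_le hlamle (fun t => hM ((r⁻¹ * (t - π x)) • v))
    hgc.aestronglyMeasurable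
  rw [measureReal_restrict_apply_univ, hvolIr] at e3
  change |∫ t, g t ∂ν - ∫ t, g t ∂lam| ≤ _ at e2
  change |(∫ t in I, g t) - ∫ t, g t ∂lam| ≤ _ at e3
  rw [hint3] at e3
  rw [← hint2, hνuniv] at e2
  rw [hint1]
  have hlam0 : 0 ≤ lam.real univ := measureReal_nonneg
  have total : |∫ y, f (r⁻¹ • (y - x)) ∂ρ - r * ∫ s : ℝ, f (s • v)| ≤
      r * (2 * R * ((1 + ε) * ω + ε * M) + δ) := by
    have t1 : ω * ρ.real univ ≤ ω * ((1 + ε) * (2 * (R * r))) := by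
      refine mul_le_mul_of_nonneg_left (hρr.trans ?_) hω0
      exact mul_le_mul_of_nonneg_left hlamr (by linarith)
    have t2 : M * (ρ.real univ - lam.real univ) ≤ M * (ε * (2 * (R * r))) := by
      refine mul_le_mul_of_nonneg_left ?_ hM0
      nlinarith [mul_le_mul_of_nonneg_left hlamr hε]
    have t3 : M * (2 * (R * r) - lam.real univ) ≤ r * δ := by
      have : M * (2 * (R * r) - lam.real univ) ≤ (M + 1) * (δ' * (2 * (R * r))) := by
        have h0 : 2 * (R * r) - lam.real univ ≤ δ' * (2 * (R * r)) := by linarith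
        have h1 : 0 ≤ δ' * (2 * (R * r)) := by positivity
        nlinarith
      refine this.trans_eq ?_
      rw [hδ'def]
      field_simp
    have tri : |∫ y, f (r⁻¹ • (y - x)) ∂ρ - r * ∫ s : ℝ, f (s • v)| ≤
        ω * ρ.real univ + M * (ρ.real univ - lam.real univ) +
          M * (2 * (R * r) - lam.real univ) := by
      rw [abs_le] at e1 e2 e3 ⊢
      constructor <;> linarith [e1.1, e1.2, e2.1, e2.2, e3.1, e3.2]
    nlinarith
  have hfac : r⁻¹ * ∫ y, f (r⁻¹ • (y - x)) ∂ρ - ∫ s : ℝ, f (s • v) =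
      r⁻¹ * (∫ y, f (r⁻¹ • (y - x)) ∂ρ - r * ∫ s : ℝ, f (s • v)) := by
    rw [mul_sub, inv_mul_cancel_left₀ hr0.ne']
  rw [hfac, abs_mul, abs_of_pos (inv_pos.2 hr0), ← div_eq_inv_mul, div_le_iff₀ hr0, mul_comm _ r]
  exact total

end Blowup

namespace IntegerRectifiableVarifold

variable {n : ℕ} (V : IntegerRectifiableVarifold n)

/-! ### The weight measure -/

instance : IsLocallyFiniteMeasure V.weight := V.locally_finite

theorem weight_absolutelyContinuous : V.weight ≪ Measure.hausdorffMeasure 1 :=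
  (withDensity_absolutelyContinuous _ _).trans Measure.restrict_le_self.absolutelyContinuous

theorem aemeasurable_mult_coe : AEMeasurable (fun x => (V.mult x : ℝ≥0∞))
    ((Measure.hausdorffMeasure 1).restrict V.carrier) :=
  measurable_from_nat.comp_aemeasurable V.mult_measurable

theorem restrict_carrier_absolutelyContinuous :
    (Measure.hausdorffMeasure 1).restrict V.carrier ≪ V.weight := by
  refine withDensity_absolutelyContinuous' V.aemeasurable_mult_coe ?_
  filter_upwards [ae_restrict_mem₀ V.carrier_measurable] with x hx
  exact Nat.cast_ne_zero.2 (Nat.one_le_iff_ne_zero.1 (V.one_le_mult x hx))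

theorem ae_mem_carrier : ∀ᵐ x ∂V.weight, x ∈ V.carrier :=
  (withDensity_absolutelyContinuous _ _).ae_le (ae_restrict_mem₀ V.carrier_measurable)

theorem weight_compl_carrier : V.weight V.carrierᶜ = 0 := V.ae_mem_carrier

theorem ae_hausdorffMeasure_of_ae_weight {p : EuclideanSpace ℝ (Fin n) → Prop}
    (h : ∀ᵐ x ∂V.weight, p x) :
    ∀ᵐ x ∂(Measure.hausdorffMeasure 1 : Measure (EuclideanSpace ℝ (Fin n))),
      x ∈ V.carrier → p x :=
  (ae_restrict_iff'₀ V.carrier_measurable).1 (V.restrict_carrier_absolutelyContinuous.ae_le h)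

theorem weight_singleton (x : EuclideanSpace ℝ (Fin n)) : V.weight {x} = 0 :=
  V.weight_absolutelyContinuous
    ((Measure.nullSingletonClass_hausdorff _ zero_lt_one).measure_singleton x)

theorem weight_restrict_eq_smul {K : Set (EuclideanSpace ℝ (Fin n))} (hK : MeasurableSet K)
    (hKc : K ⊆ V.carrier) {m : ℕ} (hm : ∀ x ∈ K, V.mult x = m) :
    V.weight.restrict K = (m : ℝ≥0∞) • (Measure.hausdorffMeasure 1).restrict K := by
  rw [weight, restrict_withDensity hK, Measure.restrict_restrict_of_subset hKc,
    ← withDensity_const]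
  refine withDensity_congr_ae ?_
  filter_upwards [ae_restrict_mem hK] with x hx
  rw [hm x hx]

/-- Up to an `ℋ¹`-null set, `Γ` is the union of Borel sets on which the multiplicity is constant. -/
theorem exists_measurable_levelSets : ∃ G : ℕ → Set (EuclideanSpace ℝ (Fin n)),
    (∀ m, MeasurableSet (G m) ∧ G m ⊆ V.carrier ∧ ∀ x ∈ G m, V.mult x = m) ∧
    Measure.hausdorffMeasure 1 (V.carrier \ ⋃ m, G m) = 0 := by
  have hnull : ∀ m : ℕ, NullMeasurableSet (V.mult ⁻¹' {m} ∩ V.carrier)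
      (Measure.hausdorffMeasure 1) := fun m =>
    (nullMeasurableSet_restrict V.carrier_measurable).1
      (V.mult_measurable.nullMeasurable (measurableSet_singleton m))
  choose G hGsub hGm hGae using fun m => (hnull m).exists_measurable_subset_ae_eq
  refine ⟨G, fun m => ⟨hGm m, fun x hx => (hGsub m hx).2, fun x hx => (hGsub m hx).1⟩, ?_⟩
  refine measure_mono_null (t := ⋃ m, (V.mult ⁻¹' {m} ∩ V.carrier) \ G m) ?_
    (measure_iUnion_null fun m => (ae_le_set.1 (hGae m).symm.le))
  rintro x ⟨hx, hxG⟩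
  refine mem_iUnion.2 ⟨V.mult x, ⟨rfl, hx⟩, fun h => hxG (mem_iUnion.2 ⟨_, h⟩)⟩

/-- `Γ` decomposes, up to a `μ_V`-null set, into countably many Borel pieces that are `ε`-flat and
have constant multiplicity. -/
theorem exists_flat_decomposition {ε : ℝ} (hε : 0 < ε) :
    ∃ 𝒦 : Set (Set (EuclideanSpace ℝ (Fin n))), 𝒦.Countable ∧
      (∀ K ∈ 𝒦, MeasurableSet K ∧ K ⊆ V.carrier ∧ (∃ m, ∀ x ∈ K, V.mult x = m) ∧
        ∃ v, ‖v‖ = 1 ∧ IsFlatAlong ε v K) ∧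
      ∀ᵐ x ∂V.weight, x ∈ ⋃₀ 𝒦 := by
  obtain ⟨G, hG, hGnull⟩ := V.exists_measurable_levelSets
  obtain ⟨F, hF, hFnull⟩ := V.rectifiable
  have hcov := fun j => (hF j).choose_spec.exists_flat_cover_range hε
  choose 𝒮 hcount h𝒮 hnull using hcov
  refine ⟨image2 (fun m S => G m ∩ S) univ (⋃ j, 𝒮 j),
    countable_univ.image2 (countable_iUnion hcount) _, ?_, ?_⟩
  · rintro _ ⟨m, -, S, hS, rfl⟩
    obtain ⟨j, hj⟩ := mem_iUnion.1 hS
    obtain ⟨hcl, v, hv, hflat⟩ := h𝒮 j S hj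
    exact ⟨(hG m).1.inter hcl.measurableSet, inter_subset_left.trans (hG m).2.1,
      ⟨m, fun x hx => (hG m).2.2 x hx.1⟩, v, hv, hflat.mono inter_subset_right⟩
  · have h1 : ∀ᵐ x ∂V.weight, x ∉ V.carrier \ ⋃ m, G m :=
      V.weight_absolutelyContinuous.ae_le (measure_eq_zero_iff_ae_notMem.1 hGnull)
    have h2 : ∀ᵐ x ∂V.weight, x ∉ V.carrier \ ⋃ j, range (F j) :=
      V.weight_absolutelyContinuous.ae_le (measure_eq_zero_iff_ae_notMem.1 hFnull)
    have h3 : ∀ᵐ x ∂V.weight, ∀ j, x ∉ range (F j) \ ⋃₀ 𝒮 j :=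
      ae_all_iff.2 fun j =>
        V.weight_absolutelyContinuous.ae_le (measure_eq_zero_iff_ae_notMem.1 (hnull j))
    filter_upwards [V.ae_mem_carrier, h1, h2, h3] with x hx hx1 hx2 hx3
    obtain ⟨m, hm⟩ := mem_iUnion.1 (not_not.1 fun h => hx1 ⟨hx, h⟩)
    obtain ⟨j, hj⟩ := mem_iUnion.1 (not_not.1 fun h => hx2 ⟨hx, h⟩)
    obtain ⟨S, hS, hxS⟩ := mem_sUnion.1 (not_not.1 fun h => hx3 j ⟨hj, h⟩)
    exact mem_sUnion.2 ⟨G m ∩ S, ⟨m, mem_univ _, S, mem_iUnion.2 ⟨j, hS⟩, rfl⟩, hm, hxS⟩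

/-! ### Approximate tangent lines -/

/-- At a.e. point the blow-ups of `μ_V` are, up to an error controlled by `ε`, those of a line. The
piece of an `ε`-flat decomposition containing `x` contributes the line integral, and the remaining
part of `μ_V` has density zero at a.e. such `x`. -/
theorem ae_exists_nearly_tangent {ε : ℝ} (hε : 0 < ε) :
    ∀ᵐ x ∂V.weight, ∃ v : EuclideanSpace ℝ (Fin n), ‖v‖ = 1 ∧
      ∀ f : EuclideanSpace ℝ (Fin n) → ℝ, Continuous f → ∀ R M ω : ℝ, 0 < R →
        (∀ a, R < ‖a‖ → f a = 0) → (∀ a, |f a| ≤ M) →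
        (∀ a b, ‖a - b‖ ≤ ε * R → |f a - f b| ≤ ω) → ∀ δ > 0, ∀ᶠ r in 𝓝[>] (0 : ℝ),
        |r⁻¹ * ∫ y, f (r⁻¹ • (y - x)) ∂V.weight - V.mult x * ∫ s : ℝ, f (s • v)| ≤
          V.mult x * (2 * R * ((1 + ε) * ω + ε * M)) + δ := by
  obtain ⟨𝒦, hcount, h𝒦, hae⟩ := V.exists_flat_decomposition hε
  have hgood : ∀ᵐ x ∂V.weight, ∀ K ∈ 𝒦, x ∉ {x ∈ K | ¬ Tendsto (fun r =>
      V.weight.restrict Kᶜ (Metric.closedBall x r) / ENNReal.ofReal r) (𝓝[>] (0 : ℝ)) (𝓝 0)} := by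
    refine (ae_ball_iff hcount).2 fun K hK => V.weight_absolutelyContinuous.ae_le
      (measure_eq_zero_iff_ae_notMem.1 (hausdorffMeasure_one_not_tendsto_div_zero _ ?_))
    rw [Measure.restrict_apply (h𝒦 K hK).1, inter_compl_self, measure_empty]
  have hdens : ∀ᵐ x ∂V.weight, ∀ K ∈ 𝒦, x ∈ K → ∃ v, ‖v‖ = 1 ∧ IsFlatAlong ε v K ∧
      Tendsto (fun r => volume ((fun y => inner ℝ v y) '' K ∩
        Metric.closedBall (inner ℝ v x) r) / volume (Metric.closedBall (inner ℝ v x) r))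
        (𝓝[>] 0) (𝓝 1) := by
    refine (ae_ball_iff hcount).2 fun K hK => ?_
    obtain ⟨hKm, -, -, v, hv, hflat⟩ := h𝒦 K hK
    have := V.weight_absolutelyContinuous.ae_le (measure_eq_zero_iff_ae_notMem.1
      (hflat.hausdorffMeasure_not_density_point hε.le hv hKm))
    filter_upwards [this] with x hx hxK
    exact ⟨v, hv, hflat, not_not.1 fun h => hx ⟨hxK, h⟩⟩
  filter_upwards [hae, hgood, hdens] with x hx hx1 hx2
  obtain ⟨K, hK, hxK⟩ := mem_sUnion.1 hx
  obtain ⟨hKm, hKc, ⟨m, hm⟩, -⟩ := h𝒦 K hK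
  obtain ⟨v, hv, hflat, hd⟩ := hx2 K hK hxK
  have hout := not_not.1 fun h => hx1 K hK ⟨hxK, h⟩
  refine ⟨v, hv, fun f hf R M ω hR hfR hM hω δ hδ => ?_⟩
  have hM0 : 0 ≤ M := (abs_nonneg _).trans (hM 0)
  have hmx : V.mult x = m := hm x hxK
  rw [hmx]
  have hδ1 : 0 < δ / (2 * (m + 1)) := by positivity
  have hδ2 : 0 < δ / (2 * R * (M + 1)) := by positivity
  have hin := hflat.eventually_abs_blowup_sub_le hε.le hv hKm hxK hd hf hR hfR hM hω hδ1
  have hout' := (hout.comp (tendsto_nhdsGT_scale hR)).eventually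
    (gt_mem_nhds (ENNReal.ofReal_pos.2 hδ2))
  filter_upwards [hin, hout', self_mem_nhdsWithin] with r hr hr' (hr0 : 0 < r)
  set B := Metric.closedBall x (R * r) with hB
  have hfB : ∀ y ∉ B, f (r⁻¹ • (y - x)) = 0 := by
    intro y hy
    rw [hB, Metric.mem_closedBall, not_le, dist_eq_norm] at hy
    refine hfR _ ?_
    rw [norm_smul, Real.norm_eq_abs, abs_of_pos (inv_pos.2 hr0), ← div_eq_inv_mul,
      lt_div_iff₀ hr0]
    exact hy
  have hBfin : V.weight B < ⊤ := measure_closedBall_lt_top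
  have hint : Integrable (fun y => f (r⁻¹ • (y - x))) V.weight := by
    refine (integrableOn_iff_integrable_of_support_subset (s := B) fun y hy => ?_).1 ?_
    · by_contra h
      exact hy (hfB y h)
    · exact Measure.integrableOn_of_bounded hBfin.ne (by fun_prop) (M := M)
        (Eventually.of_forall fun y => hM _)
  have hsplit := integral_add_compl hKm hint
  rw [V.weight_restrict_eq_smul hKm hKc hm, integral_smul_measure, ENNReal.toReal_natCast,
    smul_eq_mul] at hsplit
  have hrest : |∫ y in Kᶜ, f (r⁻¹ • (y - x)) ∂V.weight| ≤ r * (δ / 2) := by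
    have h1 : ∫ y in Kᶜ, f (r⁻¹ • (y - x)) ∂V.weight =
        ∫ y in B, f (r⁻¹ • (y - x)) ∂(V.weight.restrict Kᶜ) :=
      (setIntegral_eq_integral_of_forall_compl_eq_zero hfB).symm
    have hfin : V.weight.restrict Kᶜ B < ⊤ := measure_closedBall_lt_top
    have h2 : V.weight.restrict Kᶜ B / ENNReal.ofReal (R * r) <
        ENNReal.ofReal (δ / (2 * R * (M + 1))) := hr'
    have h3 : (V.weight.restrict Kᶜ).real B ≤ δ / (2 * R * (M + 1)) * (R * r) := by
      have h4 := (ENNReal.div_lt_iff (Or.inl (by simp; positivity)) (Or.inl (by simp))).1 h2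
      rw [← ENNReal.ofReal_mul hδ2.le] at h4
      exact ENNReal.toReal_le_of_le_ofReal (by positivity) h4.le
    rw [h1, ← Real.norm_eq_abs]
    refine (norm_setIntegral_le_of_norm_le_const hfin fun y _ => hM _).trans ?_
    calc M * (V.weight.restrict Kᶜ).real B
        ≤ (M + 1) * (δ / (2 * R * (M + 1)) * (R * r)) := by
          have h0 : 0 ≤ (V.weight.restrict Kᶜ).real B := measureReal_nonneg
          nlinarith
      _ = r * (δ / 2) := by field_simp
  have hm0 : (0 : ℝ) ≤ m := Nat.cast_nonneg m
  have hrest' : |r⁻¹ * ∫ y in Kᶜ, f (r⁻¹ • (y - x)) ∂V.weight| ≤ δ / 2 := by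
    rw [abs_mul, abs_of_pos (inv_pos.2 hr0), ← div_eq_inv_mul, div_le_iff₀ hr0, mul_comm]
    exact hrest
  have hmain : |(m : ℝ) * (r⁻¹ * ∫ y in K, f (r⁻¹ • (y - x)) ∂(Measure.hausdorffMeasure 1) -
      ∫ s : ℝ, f (s • v))| ≤ m * (2 * R * ((1 + ε) * ω + ε * M)) + δ / 2 := by
    rw [abs_mul, abs_of_nonneg hm0]
    refine (mul_le_mul_of_nonneg_left hr hm0).trans ?_
    rw [mul_add]
    have : (m : ℝ) * (δ / (2 * (m + 1))) ≤ δ / 2 := by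
      calc (m : ℝ) * (δ / (2 * (m + 1))) ≤ (m + 1) * (δ / (2 * (m + 1))) := by
            gcongr; linarith
        _ = δ / 2 := by field_simp
    linarith
  rw [← hsplit]
  have heq : r⁻¹ * (m * ∫ y in K, f (r⁻¹ • (y - x)) ∂(Measure.hausdorffMeasure 1) +
      ∫ y in Kᶜ, f (r⁻¹ • (y - x)) ∂V.weight) - m * ∫ s : ℝ, f (s • v) =
      m * (r⁻¹ * ∫ y in K, f (r⁻¹ • (y - x)) ∂(Measure.hausdorffMeasure 1) -
        ∫ s : ℝ, f (s • v)) + r⁻¹ * ∫ y in Kᶜ, f (r⁻¹ • (y - x)) ∂V.weight := by ring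
  rw [heq]
  refine (abs_add_le _ _).trans ?_
  linarith

theorem setIntegral_span_singleton {v : EuclideanSpace ℝ (Fin n)} (hv : ‖v‖ = 1)
    {f : EuclideanSpace ℝ (Fin n) → ℝ} (hf : Continuous f) :
    ∫ y in ((ℝ ∙ v : Submodule ℝ (EuclideanSpace ℝ (Fin n))) : Set (EuclideanSpace ℝ (Fin n))),
      f y ∂(Measure.hausdorffMeasure 1) = ∫ s : ℝ, f (s • v) := by
  have hiso : Isometry fun s : ℝ => s • v := by
    refine Isometry.of_dist_eq fun s t => ?_
    rw [dist_eq_norm, ← sub_smul, norm_smul, hv, mul_one, Real.dist_eq, Real.norm_eq_abs]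
  have h := hiso.map_hausdorffMeasure (d := 1) (Or.inl zero_le_one)
  rw [hausdorffMeasure_real] at h
  have hspan : ((ℝ ∙ v : Submodule ℝ (EuclideanSpace ℝ (Fin n))) :
      Set (EuclideanSpace ℝ (Fin n))) = range fun s : ℝ => s • v := by
    ext y
    simp [Submodule.mem_span_singleton]
  rw [hspan, ← h, integral_map (by fun_prop) (by fun_prop)]

/-- Existence of the approximate tangent line: its direction is a limit point of the directions
obtained for `ε = 1 / (j + 1)`. -/
theorem ae_exists_isApproxTangent : ∀ᵐ x ∂V.weight, ∃ P, V.IsApproxTangent x P := by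
  have hall : ∀ᵐ x ∂V.weight, ∀ j : ℕ, _ :=
    ae_all_iff.2 fun j => V.ae_exists_nearly_tangent (ε := 1 / ((j : ℝ) + 1)) (by positivity)
  filter_upwards [hall] with x hx
  choose v hv hconv using hx
  obtain ⟨w, hw, φ, hφ, hlim⟩ := (isCompact_sphere (0 : EuclideanSpace ℝ (Fin n)) 1).tendsto_subseq
    (x := v) fun j => by simpa using hv j
  have hw1 : ‖w‖ = 1 := by simpa using hw
  refine ⟨ℝ ∙ w, finrank_span_singleton (by rintro rfl; simp at hw1), fun f hf hfc => ?_⟩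
  rw [setIntegral_span_singleton hw1 hf]
  obtain ⟨M, hM⟩ := hfc.exists_bound_of_continuous hf
  obtain ⟨R, hR, hfR⟩ : ∃ R : ℝ, 0 < R ∧ ∀ a, R < ‖a‖ → f a = 0 := by
    obtain ⟨R, hR0, hR⟩ := hfc.isCompact.isBounded.exists_pos_norm_le
    refine ⟨R, hR0, fun a ha => ?_⟩
    by_contra h
    exact (hR a (subset_tsupport f h)).not_gt ha
  have hM0 : 0 ≤ M := (norm_nonneg _).trans (hM 0)
  -- the line integrals along the approximating directions converge
  have hdir : Tendsto (fun i => ∫ s : ℝ, f (s • v (φ i))) atTop (𝓝 (∫ s : ℝ, f (s • w))) := by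
    refine tendsto_integral_of_dominated_convergence
      ((Metric.closedBall (0 : ℝ) R).indicator fun _ => M) (fun i => by fun_prop) ?_ ?_ ?_
    · exact (integrable_indicator_iff measurableSet_closedBall).2
        (integrableOn_const (measure_closedBall_lt_top.ne))
    · refine fun i => Eventually.of_forall fun s => ?_
      by_cases hs : s ∈ Metric.closedBall (0 : ℝ) R
      · rw [indicator_of_mem hs]; exact hM _
      · rw [indicator_of_notMem hs, hfR _ ?_, norm_zero]
        rw [norm_smul, hv, mul_one]
        simpa using hs
    · exact Eventually.of_forall fun s =>
        (hf.tendsto _).comp (tendsto_const_nhds.smul hlim)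
  set θ : ℝ := (V.mult x : ℝ) with hθ
  have hθ0 : 0 ≤ θ := Nat.cast_nonneg _
  rw [Metric.tendsto_nhds]
  intro η hη
  have hω : 0 < η / (16 * (R * (θ + 1))) := by positivity
  obtain ⟨d, hd, hfd⟩ := Metric.uniformContinuous_iff_le.1
    (hfc.uniformContinuous_of_continuous hf) _ hω
  have hεlim : Tendsto (fun i => 1 / (((φ i : ℕ) : ℝ) + 1)) atTop (𝓝 0) :=
    tendsto_one_div_add_atTop_nhds_zero_nat.comp hφ.tendsto_atTop
  have ev1 : ∀ᶠ i in atTop, 1 / (((φ i : ℕ) : ℝ) + 1) * R < d := by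
    refine (hεlim.mul_const R).eventually (gt_mem_nhds ?_)
    simpa using hd
  have ev2 : ∀ᶠ i in atTop, θ * (2 * R * (1 / (((φ i : ℕ) : ℝ) + 1) * M)) < η / 4 := by
    refine (((hεlim.mul_const M).const_mul (2 * R)).const_mul θ).eventually (gt_mem_nhds ?_)
    simpa using hη
  have ev3 : ∀ᶠ i in atTop, |(θ * ∫ s : ℝ, f (s • v (φ i))) - θ * ∫ s : ℝ, f (s • w)| < η / 4 := by
    have := Metric.tendsto_nhds.1 (hdir.const_mul θ) (η / 4) (by positivity)
    simpa only [Real.dist_eq] using this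
  obtain ⟨i, h1, h2, h3⟩ := (ev1.and (ev2.and ev3)).exists
  have hle1 : 1 / (((φ i : ℕ) : ℝ) + 1) ≤ 1 := by
    rw [div_le_one (by positivity)]; simp
  filter_upwards [hconv (φ i) f hf R M _ hR hfR hM (fun a b hab => by
    have := hfd ((dist_eq_norm a b).trans_le (hab.trans h1.le))
    rwa [Real.dist_eq] at this) (η / 8) (by positivity)] with r hr
  rw [Real.dist_eq]
  have hbound : θ * (2 * R * ((1 + 1 / (((φ i : ℕ) : ℝ) + 1)) * (η / (16 * (R * (θ + 1))))))
      ≤ η / 4 := by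
    calc θ * (2 * R * ((1 + 1 / (((φ i : ℕ) : ℝ) + 1)) * (η / (16 * (R * (θ + 1))))))
        ≤ (θ + 1) * (2 * R * ((1 + 1) * (η / (16 * (R * (θ + 1)))))) := by
          gcongr; linarith
      _ = η / 4 := by field_simp; ring
  rw [mul_add (2 * R), mul_add θ, abs_le] at hr
  rw [abs_lt] at h3 ⊢
  constructor <;> linarith [hr.1, hr.2, h3.1, h3.2]

end IntegerRectifiableVarifold

namespace IntegerRectifiableVarifold

variable {n : ℕ} (V : IntegerRectifiableVarifold n)

/-! ### Density and measurability of the tangent line -/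

/-- An approximate tangent space is a line `ℝ v` with `|v| = 1`, and the blow-up limit is a line
integral over `ℝ`. -/
theorem IsApproxTangent.exists_eq_span {V : IntegerRectifiableVarifold n}
    {x : EuclideanSpace ℝ (Fin n)} {P : Submodule ℝ (EuclideanSpace ℝ (Fin n))}
    (h : V.IsApproxTangent x P) :
    ∃ v : EuclideanSpace ℝ (Fin n), ‖v‖ = 1 ∧ P = ℝ ∙ v ∧
      ∀ f : EuclideanSpace ℝ (Fin n) → ℝ, Continuous f → HasCompactSupport f →
        Tendsto (fun r : ℝ => r⁻¹ * ∫ y, f (r⁻¹ • (y - x)) ∂V.weight) (𝓝[>] 0)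
          (𝓝 (V.mult x * ∫ s : ℝ, f (s • v))) := by
  obtain ⟨w, hw, hspan⟩ := finrank_eq_one_iff'.1 h.1
  have hw0 : (w : EuclideanSpace ℝ (Fin n)) ≠ 0 := by simpa using hw
  have hv : ‖‖(w : EuclideanSpace ℝ (Fin n))‖⁻¹ • (w : EuclideanSpace ℝ (Fin n))‖ = 1 := by
    rw [norm_smul, norm_inv, norm_norm, inv_mul_cancel₀ (norm_ne_zero_iff.2 hw0)]
  have hP : P = ℝ ∙ (‖(w : EuclideanSpace ℝ (Fin n))‖⁻¹ • (w : EuclideanSpace ℝ (Fin n))) := by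
    rw [Submodule.span_singleton_smul_eq (inv_ne_zero (norm_ne_zero_iff.2 hw0)).isUnit]
    refine le_antisymm (fun y hy => ?_) ((Submodule.span_singleton_le_iff_mem _ _).2 w.2)
    obtain ⟨c, hc⟩ := hspan ⟨y, hy⟩
    exact Submodule.mem_span_singleton.2 ⟨c, congrArg Subtype.val hc⟩
  refine ⟨_, hv, hP, fun f hf hfc => ?_⟩
  rw [← setIntegral_span_singleton hv hf, ← hP]
  exact h.2 f hf hfc

theorem ae_isApproxTangent_tangent : ∀ᵐ x ∂V.weight, V.IsApproxTangent x (V.tangent x) := by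
  filter_upwards [V.ae_exists_isApproxTangent] with x hx
  rw [tangent, dif_pos hx]
  exact hx.choose_spec

/-- Where the approximate tangent line and the density exist, the density is the multiplicity: the
blow-up is tested with piecewise linear `f` equal to `1` on `B_{1-η}(0)` and to `0` off `B_1(0)`. -/
theorem IsApproxTangent.density_eq {V : IntegerRectifiableVarifold n}
    {x : EuclideanSpace ℝ (Fin n)} {P : Submodule ℝ (EuclideanSpace ℝ (Fin n))}
    (h : V.IsApproxTangent x P) {D : ℝ}
    (hD : Tendsto (fun r => V.weight.real (Metric.ball x r) / r) (𝓝[>] 0) (𝓝 D)) :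
    D = 2 * V.mult x := by
  obtain ⟨v, hv, -, hlim⟩ := h.exists_eq_span
  have key : ∀ η : ℝ, 0 < η → η < 1 →
      V.mult x * (2 * (1 - η)) ≤ D ∧ (1 - η) * D ≤ V.mult x * 2 := by
    intro η hη hη1
    set f : EuclideanSpace ℝ (Fin n) → ℝ := fun a => max 0 (min 1 ((1 - ‖a‖) / η)) with hf
    have hfc : Continuous f := by fun_prop
    have hf0 : ∀ a, 1 ≤ ‖a‖ → f a = 0 := fun a ha =>
      max_eq_left ((min_le_right _ _).trans (div_nonpos_of_nonpos_of_nonneg (by linarith) hη.le))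
    have hf1 : ∀ a, ‖a‖ ≤ 1 - η → f a = 1 := fun a ha => by
      have : 1 ≤ (1 - ‖a‖) / η := (one_le_div hη).2 (by linarith)
      rw [hf]
      simp [min_eq_left this]
    have hfn : ∀ a, 0 ≤ f a := fun a => le_max_left _ _
    have hfle : ∀ a, f a ≤ 1 := fun a => max_le zero_le_one (min_le_left _ _)
    have hfs : HasCompactSupport f := HasCompactSupport.of_support_subset_isCompact
      (isCompact_closedBall 0 1) fun a ha => by
        by_contra hcon
        rw [mem_closedBall_zero_iff, not_le] at hcon
        exact ha (hf0 a hcon.le)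
    have hball : ∀ R : ℝ, 0 ≤ R → ∫ s in Metric.closedBall (0 : ℝ) R, (1 : ℝ) = 2 * R := by
      intro R hR
      rw [setIntegral_const, smul_eq_mul, mul_one, measureReal_def, Real.volume_closedBall,
        ENNReal.toReal_ofReal (by positivity)]
    have hgs : ∀ s : ℝ, ‖s • v‖ = |s| := fun s => by rw [norm_smul, hv, mul_one, Real.norm_eq_abs]
    have hgc : Continuous fun s : ℝ => f (s • v) := by fun_prop
    have hJ : ∫ s : ℝ, f (s • v) = ∫ s in Metric.closedBall (0 : ℝ) 1, f (s • v) :=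
      (setIntegral_eq_integral_of_forall_compl_eq_zero fun s hs => hf0 _ (by
        rw [hgs]
        rw [mem_closedBall_zero_iff, not_le] at hs
        exact hs.le)).symm
    have hint : ∀ R : ℝ, IntegrableOn (fun s : ℝ => f (s • v)) (Metric.closedBall 0 R) :=
      fun R => hgc.continuousOn.integrableOn_compact (isCompact_closedBall _ _)
    have hJ2 : ∫ s : ℝ, f (s • v) ≤ 2 := by
      rw [hJ, ← mul_one (2 : ℝ), ← hball 1 zero_le_one]
      exact setIntegral_mono (hint 1) (integrableOn_const measure_closedBall_lt_top.ne)
        fun s => hfle _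
    have hJ1 : 2 * (1 - η) ≤ ∫ s : ℝ, f (s • v) := by
      rw [hJ, ← hball (1 - η) (by linarith)]
      calc ∫ s in Metric.closedBall (0 : ℝ) (1 - η), (1 : ℝ)
          = ∫ s in Metric.closedBall (0 : ℝ) (1 - η), f (s • v) :=
            setIntegral_congr_fun measurableSet_closedBall fun s hs => (hf1 _ (by
              rw [hgs]; simpa using hs)).symm
        _ ≤ _ := setIntegral_mono_set (hint 1) (Eventually.of_forall fun s => hfn _)
            (Metric.closedBall_subset_closedBall (by linarith)).eventuallyLE
    have hθ : (0 : ℝ) ≤ V.mult x := Nat.cast_nonneg _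
    have hLam := hlim f hfc hfs
    have hfin : ∀ R, V.weight (Metric.ball x R) ≠ ⊤ := fun R => measure_ball_lt_top.ne
    have hfi : ∀ r : ℝ, 0 < r → IntegrableOn (fun y => f (r⁻¹ • (y - x))) (Metric.ball x r)
        V.weight := fun r hr =>
      Measure.integrableOn_of_bounded (hfin r) (by fun_prop) (M := 1)
        (Eventually.of_forall fun y => by
          rw [Real.norm_eq_abs, abs_of_nonneg (hfn _)]; exact hfle _)
    have hrescale : ∀ r : ℝ, 0 < r → ∀ y, ‖r⁻¹ • (y - x)‖ = dist y x / r := fun r hr y => by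
      rw [norm_smul, Real.norm_eq_abs, abs_of_pos (inv_pos.2 hr), ← div_eq_inv_mul, dist_eq_norm]
    have hball_eq : ∀ r : ℝ, 0 < r → ∫ y, f (r⁻¹ • (y - x)) ∂V.weight =
        ∫ y in Metric.ball x r, f (r⁻¹ • (y - x)) ∂V.weight := fun r hr =>
      (setIntegral_eq_integral_of_forall_compl_eq_zero fun y hy => hf0 _ (by
        rw [hrescale r hr, one_le_div hr]
        simpa using hy)).symm
    constructor
    · refine (mul_le_mul_of_nonneg_left hJ1 hθ).trans (le_of_tendsto_of_tendsto hLam hD ?_)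
      filter_upwards [self_mem_nhdsWithin] with r (hr : 0 < r)
      rw [div_eq_inv_mul, hball_eq r hr]
      refine mul_le_mul_of_nonneg_left ?_ (inv_pos.2 hr).le
      calc ∫ y in Metric.ball x r, f (r⁻¹ • (y - x)) ∂V.weight
          ≤ ∫ y in Metric.ball x r, (1 : ℝ) ∂V.weight :=
            setIntegral_mono (hfi r hr) (integrableOn_const (hfin r)) fun y => hfle _
        _ = V.weight.real (Metric.ball x r) := by simp
    · have hη' : 0 < 1 - η := by linarith
      have hD' := (hD.comp (tendsto_nhdsGT_scale hη')).const_mul (1 - η)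
      refine (le_of_tendsto_of_tendsto hD' hLam ?_).trans (mul_le_mul_of_nonneg_left hJ2 hθ)
      filter_upwards [self_mem_nhdsWithin] with r (hr : 0 < r)
      have hsub : Metric.ball x ((1 - η) * r) ⊆ Metric.ball x r :=
        Metric.ball_subset_ball (by nlinarith)
      have heq : (1 - η) * (V.weight.real (Metric.ball x ((1 - η) * r)) / ((1 - η) * r)) =
          r⁻¹ * V.weight.real (Metric.ball x ((1 - η) * r)) := by
        field_simp
      simp only [Function.comp_apply]
      rw [heq, hball_eq r hr]
      refine mul_le_mul_of_nonneg_left ?_ (inv_pos.2 hr).le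
      calc V.weight.real (Metric.ball x ((1 - η) * r))
          = ∫ y in Metric.ball x ((1 - η) * r), (1 : ℝ) ∂V.weight := by simp
        _ = ∫ y in Metric.ball x ((1 - η) * r), f (r⁻¹ • (y - x)) ∂V.weight :=
            setIntegral_congr_fun measurableSet_ball fun y hy => (hf1 _ (by
              rw [hrescale r hr, div_le_iff₀ hr]
              exact (Metric.mem_ball.1 hy).le)).symm
        _ ≤ _ := setIntegral_mono_set (hfi r hr) (Eventually.of_forall fun s => hfn _)
            hsub.eventuallyLE
  have hev : ∀ᶠ η : ℝ in 𝓝[>] 0, 0 < η ∧ η < 1 := by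
    filter_upwards [Ioo_mem_nhdsGT (zero_lt_one' ℝ)] with η hη using hη
  have t1 : Tendsto (fun η : ℝ => V.mult x * (2 * (1 - η))) (𝓝[>] 0) (𝓝 (2 * V.mult x)) := by
    have : Continuous fun η : ℝ => (V.mult x : ℝ) * (2 * (1 - η)) := by fun_prop
    have h := (this.tendsto 0).mono_left (nhdsWithin_le_nhds (s := Ioi (0 : ℝ)))
    rwa [sub_zero, mul_one, mul_comm] at h
  have t2 : Tendsto (fun η : ℝ => (1 - η) * D) (𝓝[>] 0) (𝓝 D) := by
    have : Continuous fun η : ℝ => (1 - η) * D := by fun_prop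
    have h := (this.tendsto 0).mono_left (nhdsWithin_le_nhds (s := Ioi (0 : ℝ)))
    rwa [sub_zero, one_mul] at h
  refine le_antisymm (le_of_tendsto t2 ?_) (le_of_tendsto t1 ?_)
  · filter_upwards [hev] with η hη
    linarith [(key η hη.1 hη.2).2]
  · filter_upwards [hev] with η hη
    exact (key η hη.1 hη.2).1

/-- The tangent line depends measurably on the point, in the form needed below. For `w = x - x₀` the
blow-up of `μ_V` at `x`, tested with `f_w(a) = max(0, 1 - |a|) ⟨a, w⟩²`, converges to
`θ(x) c |π_{T_xΓ} w|²`, where `c > 0` is a constant; before the limit, these are measurable functions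
of `x`. Without this, the integral of the tangential divergence in the first variation formula could
carry the junk value `0`. -/
theorem aemeasurable_norm_tangent_projection_sq (x₀ : EuclideanSpace ℝ (Fin n)) :
    AEMeasurable (fun x => ‖(V.tangent x).starProjection (x - x₀)‖ ^ 2) V.weight := by
  set c : ℝ := ∫ s : ℝ, max 0 (1 - |s|) * s ^ 2 with hc
  have hcpos : 0 < c := by
    refine Continuous.integral_pos_of_hasCompactSupport_nonneg_nonzero (x := 1 / 2) (by fun_prop)
      (HasCompactSupport.of_support_subset_isCompact (isCompact_closedBall 0 1) fun s hs => ?_)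
      (fun s => by positivity) ?_
    · by_contra hcon
      rw [mem_closedBall_zero_iff, not_le, Real.norm_eq_abs] at hcon
      refine hs ?_
      change max 0 (1 - |s|) * s ^ 2 = 0
      rw [max_eq_left (by linarith), zero_mul]
    · rw [abs_of_pos (by norm_num)]
      norm_num
  set r : ℕ → ℝ := fun m => 1 / ((m : ℝ) + 1) with hr
  have hr0 : Tendsto r atTop (𝓝[>] 0) := tendsto_nhdsWithin_iff.2
    ⟨tendsto_one_div_add_atTop_nhds_zero_nat, Eventually.of_forall fun m => by
      rw [hr]; exact mem_Ioi.2 (by positivity)⟩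
  set f : EuclideanSpace ℝ (Fin n) → EuclideanSpace ℝ (Fin n) → ℝ :=
    fun w a => max 0 (1 - ‖a‖) * (inner ℝ a w) ^ 2 with hf
  have hmult : AEMeasurable (fun x => (V.mult x : ℝ)) V.weight :=
    (measurable_from_nat.comp_aemeasurable V.mult_measurable).mono_ac
      (withDensity_absolutelyContinuous _ _)
  refine aemeasurable_of_tendsto_metrizable_ae (u := atTop)
    (f := fun m x => ((r m)⁻¹ * ∫ y, f (x - x₀) ((r m)⁻¹ • (y - x)) ∂V.weight) / (V.mult x * c))
    (fun m => ?_) ?_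
  · refine AEMeasurable.div ?_ (hmult.mul_const c)
    refine (StronglyMeasurable.measurable ?_).aemeasurable
    refine StronglyMeasurable.const_mul (StronglyMeasurable.integral_prod_right
      (f := fun x y => f (x - x₀) ((r m)⁻¹ • (y - x))) ?_) _
    refine Continuous.stronglyMeasurable ?_
    simp only [hf, Function.uncurry_def]
    fun_prop
  · filter_upwards [V.ae_isApproxTangent_tangent, V.ae_mem_carrier] with x hx hxc
    obtain ⟨v, hv, hP, hlim⟩ := hx.exists_eq_span
    have hθ : (V.mult x : ℝ) ≠ 0 :=
      Nat.cast_ne_zero.2 (Nat.one_le_iff_ne_zero.1 (V.one_le_mult x hxc))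
    have h1 := (hlim (f (x - x₀)) (by fun_prop)
      (HasCompactSupport.of_support_subset_isCompact (isCompact_closedBall 0 1) fun a ha => by
        by_contra hcon
        rw [mem_closedBall_zero_iff, not_le] at hcon
        exact ha (by simp only [hf]; rw [max_eq_left (by linarith), zero_mul]))).comp hr0
    have h2 : ∫ s : ℝ, f (x - x₀) (s • v) =
        c * ‖(V.tangent x).starProjection (x - x₀)‖ ^ 2 := by
      rw [hP, Submodule.starProjection_unit_singleton ℝ hv, norm_smul, hv, mul_one,
        Real.norm_eq_abs, sq_abs, hc, ← integral_mul_const]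
      refine integral_congr_ae (Eventually.of_forall fun s => ?_)
      simp only [hf]
      rw [norm_smul, hv, mul_one, Real.norm_eq_abs, real_inner_smul_left]
      ring
    rw [h2, ← mul_assoc] at h1
    have h3 := h1.div_const (V.mult x * c)
    rwa [mul_div_cancel_left₀ _ (mul_ne_zero hθ hcpos.ne')] at h3

theorem tangentialDiv_eq_inner {x v : EuclideanSpace ℝ (Fin n)} (hv : ‖v‖ = 1)
    (hx : V.tangent x = ℝ ∙ v) {X : EuclideanSpace ℝ (Fin n) → EuclideanSpace ℝ (Fin n)}
    {L : EuclideanSpace ℝ (Fin n) →L[ℝ] EuclideanSpace ℝ (Fin n)} (hL : HasFDerivAt X L x) :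
    V.tangentialDiv X x = inner ℝ v (L v) := by
  rw [tangentialDiv, hL.fderiv]
  change LinearMap.trace ℝ _ ((V.tangent x).starProjection ∘L L).toLinearMap = _
  rw [hx]
  have : ((ℝ ∙ v).starProjection ∘L L).toLinearMap =
      ((innerSL ℝ v ∘L L).toLinearMap).smulRight v := by
    ext1 w
    simp [Submodule.starProjection_unit_singleton ℝ hv]
  rw [this, LinearMap.trace_smulRight]
  simp

end IntegerRectifiableVarifold

/-! ### The radial test field -/

/-- A `C¹` primitive `H` of a cutoff `c` of the interval `[a, b]`: up to the error `η`, the function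
`H` is the truncation `t ↦ min t b - a`, cut off at `0` for `t ≤ a`. -/
theorem exists_primitive_of_cutoff {a b η : ℝ} (ha : 0 < a) (hab : a < b) (hη : 0 < η) :
    ∃ H c : ℝ → ℝ, Continuous c ∧ (∀ t, HasDerivAt H (c t) t) ∧ (∀ t, 0 ≤ c t ∧ c t ≤ 1) ∧
      (∀ t ≤ a, H t = 0 ∧ c t = 0) ∧ (∀ t, b ≤ t → H t = H b ∧ c t = 0) ∧
      (∀ t, 0 ≤ H t ∧ H t ≤ b) ∧ (∀ t, 0 ≤ t → H t ≤ t) ∧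
      (∀ t, a ≤ t → t ≤ b → t - a - η ≤ H t) := by
  set δ := min (η / 2) ((b - a) / 4) with hδ
  have hδ0 : 0 < δ := lt_min (by linarith) (by linarith)
  have hδη : δ ≤ η / 2 := min_le_left _ _
  have hδb : δ ≤ (b - a) / 4 := min_le_right _ _
  let g : ContDiffBump ((a + b) / 2) := ⟨(b - a) / 2 - δ, (b - a) / 2, by linarith, by linarith⟩
  have hgc : Continuous g := g.continuous
  have hgi : ∀ s t : ℝ, IntervalIntegrable g volume s t := fun s t => hgc.intervalIntegrable s t
  have hg0 : ∀ t, t ≤ a ∨ b ≤ t → g t = 0 := fun t ht => by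
    refine g.zero_of_le_dist ?_
    rw [Real.dist_eq]
    rcases ht with h | h
    · rw [abs_of_nonpos (by linarith)]
      change (b - a) / 2 ≤ _
      linarith
    · rw [abs_of_nonneg (by linarith)]
      change (b - a) / 2 ≤ _
      linarith
  set H : ℝ → ℝ := fun t => ∫ s in a..t, g s with hH
  have hsub : ∀ s t, H t - H s = ∫ u in s..t, g u := fun s t =>
    intervalIntegral.integral_interval_sub_left (hgi _ _) (hgi _ _)
  have hmono : ∀ s t, s ≤ t → 0 ≤ H t - H s := fun s t hst => by
    rw [hsub]
    exact intervalIntegral.integral_nonneg hst fun u _ => g.nonneg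
  have hlip : ∀ s t, s ≤ t → H t - H s ≤ t - s := fun s t hst => by
    rw [hsub]
    calc ∫ u in s..t, g u ≤ ∫ u in s..t, (1 : ℝ) :=
          intervalIntegral.integral_mono hst (hgi _ _) (by simp) fun u => g.le_one
      _ = t - s := by simp
  have hzero : ∀ s t, (∀ u ∈ uIcc s t, g u = 0) → H t = H s := fun s t h => by
    rw [← sub_eq_zero, hsub, intervalIntegral.integral_congr (g := fun _ => 0) h]
    simp
  have hHa : H a = 0 := intervalIntegral.integral_same
  have hHle : ∀ t ≤ a, H t = 0 := fun t ht => by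
    rw [← hHa]
    refine hzero a t fun u hu => hg0 u (Or.inl ?_)
    rw [uIcc_of_ge ht] at hu
    exact hu.2
  have hHge : ∀ t, b ≤ t → H t = H b := fun t ht => by
    refine hzero b t fun u hu => hg0 u (Or.inr ?_)
    rw [uIcc_of_le ht] at hu
    exact hu.1
  have hHb : b - a - η ≤ H b := by
    have h1 : H b = ∫ u, g u := intervalIntegral.integral_eq_integral_of_support_subset fun u hu => by
      refine ⟨?_, ?_⟩
      · by_contra h
        exact hu (hg0 u (Or.inl (not_lt.1 h)))
      · by_contra h
        exact hu (hg0 u (Or.inr (not_le.1 h).le))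
    have h2 := g.measure_closedBall_le_integral volume
    rw [measureReal_def, Real.volume_closedBall, ENNReal.toReal_ofReal
      (by linarith [g.rIn_pos])] at h2
    change 2 * ((b - a) / 2 - δ) ≤ _ at h2
    rw [h1]
    linarith
  refine ⟨H, g, hgc, fun t => intervalIntegral.integral_hasDerivAt_right (hgi _ _)
    (hgc.stronglyMeasurableAtFilter _ _) hgc.continuousAt, fun t => ⟨g.nonneg, g.le_one⟩,
    fun t ht => ⟨hHle t ht, hg0 t (Or.inl ht)⟩, fun t ht => ⟨hHge t ht, hg0 t (Or.inr ht)⟩,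
    fun t => ?_, fun t ht => ?_, fun t _ htb => ?_⟩
  · rcases le_total t a with h | h
    · rw [hHle t h]; exact ⟨le_rfl, (ha.trans hab).le⟩
    · refine ⟨by linarith [hmono a t h], ?_⟩
      rcases le_total t b with h' | h'
      · linarith [hlip a t h]
      · rw [hHge t h']; linarith [hlip a b hab.le]
  · rcases le_total t a with h | h
    · rw [hHle t h]; exact ht
    · linarith [hlip a t h]
  · linarith [hlip t b htb]

section RadialField

variable {E : Type*} [NormedAddCommGroup E] [InnerProductSpace ℝ E]

/-- The radial vector field `z ↦ H (1 / |z - x₀|) (z - x₀)`; at `z = x₀`, where the inverse of the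
norm takes the junk value `0`, the field vanishes whatever `H` is. -/
noncomputable def radialField (H : ℝ → ℝ) (x₀ : E) (z : E) : E := H (‖z - x₀‖⁻¹) • (z - x₀)

theorem hasFDerivAt_radialField {H c : ℝ → ℝ} (hH : ∀ t, HasDerivAt H (c t) t) {x₀ z : E}
    (hz : z ≠ x₀) :
    HasFDerivAt (radialField H x₀)
      (H (‖z - x₀‖⁻¹) • ContinuousLinearMap.id ℝ E -
        (c (‖z - x₀‖⁻¹) / ‖z - x₀‖ ^ 3) • (innerSL ℝ (z - x₀)).smulRight (z - x₀)) z := by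
  have hz0 : 0 < ‖z - x₀‖ := norm_pos_iff.2 (sub_ne_zero.2 hz)
  have hq0 : 0 < ‖z - x₀‖ ^ 2 := by positivity
  have hq : HasFDerivAt (fun z => ‖z - x₀‖ ^ 2) (2 • innerSL ℝ (z - x₀)) z := by
    have := ((hasFDerivAt_id (𝕜 := ℝ) z).sub_const x₀).norm_sq
    simpa using this
  have hs : HasDerivAt (fun u => H ((Real.sqrt u)⁻¹)) (c ((Real.sqrt (‖z - x₀‖ ^ 2))⁻¹) *
      (-(1 / (2 * Real.sqrt (‖z - x₀‖ ^ 2))) / Real.sqrt (‖z - x₀‖ ^ 2) ^ 2)) (‖z - x₀‖ ^ 2) :=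
    (hH _).comp _ ((Real.hasDerivAt_sqrt hq0.ne').inv (Real.sqrt_pos.2 hq0).ne')
  rw [Real.sqrt_sq hz0.le] at hs
  have hprof := hs.comp_hasFDerivAt z hq
  have h := hprof.smul ((hasFDerivAt_id (𝕜 := ℝ) z).sub_const x₀)
  have h' := h.congr_of_eventuallyEq (f₁ := radialField H x₀) (Eventually.of_forall fun w => by
    simp [radialField, Real.sqrt_sq (norm_nonneg _)])
  refine h'.congr_fderiv ?_
  ext1 w
  simp only [Function.comp_apply, Real.sqrt_sq hz0.le, id, sub_apply, add_apply, smul_apply,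
    ContinuousLinearMap.smulRight_apply, ContinuousLinearMap.id_apply, innerSL_apply_apply,
    smul_smul, smul_eq_mul]
  rw [sub_eq_add_neg (H _ • w), ← neg_smul]
  congr 2
  simp only [nsmul_eq_mul, Nat.cast_ofNat]
  field_simp

/-- If `H` is constant on `[b, ∞)`, the radial field is linear in the ball of radius `1 / b` around
`x₀`, hence `C¹` across the centre. -/
theorem contDiff_radialField {H c : ℝ → ℝ} (hc : Continuous c) (hH : ∀ t, HasDerivAt H (c t) t)
    {b : ℝ} (hb : 0 < b) (hHb : ∀ t, b ≤ t → H t = H b) (x₀ : E) :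
    ContDiff ℝ 1 (radialField H x₀) := by
  have hH1 : ContDiff ℝ 1 H := by
    rw [contDiff_one_iff_deriv]
    refine ⟨fun t => (hH t).differentiableAt, ?_⟩
    rwa [funext fun t => (hH t).deriv]
  rw [contDiff_iff_contDiffAt]
  intro z
  by_cases hz : z = x₀
  · have hlin : ContDiffAt ℝ 1 (fun z => H b • (z - x₀)) z := by fun_prop
    refine hlin.congr_of_eventuallyEq ?_
    filter_upwards [Metric.ball_mem_nhds z (inv_pos.2 hb)] with w hw
    rw [hz, mem_ball_iff_norm] at hw
    rw [radialField]
    rcases eq_or_ne w x₀ with rfl | hne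
    · simp
    · rw [hHb _ ((le_inv_comm₀ hb (norm_pos_iff.2 (sub_ne_zero.2 hne))).2 hw.le)]
  · have h0 : z - x₀ ≠ 0 := sub_ne_zero.2 hz
    have hsub : ContDiffAt ℝ 1 (fun z => z - x₀) z := by fun_prop
    exact (hH1.contDiffAt.comp z ((hsub.norm ℝ h0).inv (norm_ne_zero_iff.2 h0))).smul hsub

end RadialField

namespace IntegerRectifiableVarifold

variable {n : ℕ} {V : IntegerRectifiableVarifold n}
  {k : EuclideanSpace ℝ (Fin n) → EuclideanSpace ℝ (Fin n)}

/-! ### The monotonicity inequality -/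

/-- The tangential divergence of a radial field, off the centre `x₀`, which is `μ_V`-null. -/
theorem ae_tangentialDiv_radialField_eq {H c : ℝ → ℝ} (hH : ∀ t, HasDerivAt H (c t) t)
    (x₀ : EuclideanSpace ℝ (Fin n)) :
    ∀ᵐ x ∂V.weight, V.tangentialDiv (radialField H x₀) x = H (‖x - x₀‖⁻¹) -
      c (‖x - x₀‖⁻¹) / ‖x - x₀‖ ^ 3 * ‖(V.tangent x).starProjection (x - x₀)‖ ^ 2 := by
  filter_upwards [V.ae_isApproxTangent_tangent,
    measure_eq_zero_iff_ae_notMem.1 (V.weight_singleton x₀)] with x hx hne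
  obtain ⟨v, hv, hP, -⟩ := hx.exists_eq_span
  rw [V.tangentialDiv_eq_inner hv hP (hasFDerivAt_radialField hH hne), hP,
    Submodule.starProjection_unit_singleton ℝ hv, norm_smul, hv, mul_one, Real.norm_eq_abs, sq_abs]
  simp only [sub_apply, smul_apply,
    ContinuousLinearMap.smulRight_apply, ContinuousLinearMap.id_apply, innerSL_apply_apply,
    inner_sub_right, inner_smul_right, real_inner_self_eq_norm_sq, hv]
  rw [real_inner_comm v (x - x₀), inner_sub_right]
  ring

theorem HasCurvatureNoBoundary.integrableOn_ball (hk : V.HasCurvatureNoBoundary k)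
    (x₀ : EuclideanSpace ℝ (Fin n)) (ρ : ℝ) : IntegrableOn k (Metric.ball x₀ ρ) V.weight :=
  (hk.1.integrableOn_isCompact (isCompact_closedBall x₀ ρ)).mono_set Metric.ball_subset_closedBall

/-- The monotonicity inequality. It comes from testing the first variation formula with the field
`X = H(1/|z|) z`, `z = x - x₀`, where `H' = c` is a smooth approximation of the indicator function
of `[1/ρ, 1/σ]`. Then `|X| ≤ 1`, `X` is supported in `B_ρ(x₀)`, and with `τ = 1/|z|` the tangential
divergence is at least `H(τ) - τ c(τ)`, that is, up to a small error, at least `1/σ - 1/ρ` on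
`B_σ(x₀)` and at least `-1/ρ` on the rest of `B_ρ(x₀)`. -/
theorem HasCurvatureNoBoundary.weight_ball_div_le (hk : V.HasCurvatureNoBoundary k)
    (x₀ : EuclideanSpace ℝ (Fin n)) {σ ρ : ℝ} (hσ : 0 < σ) (hσρ : σ < ρ) :
    V.weight.real (Metric.ball x₀ σ) / σ ≤ V.weight.real (Metric.ball x₀ ρ) / ρ +
      ∫ x in Metric.ball x₀ ρ, ‖k x‖ ∂V.weight := by
  have hρ : 0 < ρ := hσ.trans hσρ
  have hab : ρ⁻¹ < σ⁻¹ := (inv_lt_inv₀ hρ hσ).2 hσρ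
  have hfin : ∀ R, V.weight (Metric.ball x₀ R) ≠ ⊤ := fun R => measure_ball_lt_top.ne
  refine le_of_forall_pos_le_add fun ε hε => ?_
  set m := V.weight.real (Metric.ball x₀ ρ) with hm
  have hm0 : 0 ≤ m := measureReal_nonneg
  have hη : 0 < ε / (m + 1) := by positivity
  set η := ε / (m + 1) with hηdef
  obtain ⟨H, c, hc, hH, hc01, hlow, hhigh, hHb, hHt, hHlow⟩ :=
    exists_primitive_of_cutoff (inv_pos.2 hρ) hab hη
  set X := radialField H x₀ with hX
  have hXc : ContDiff ℝ 1 X :=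
    contDiff_radialField hc hH (inv_pos.2 hσ) (fun t ht => (hhigh t ht).1) x₀
  have hout : ∀ x ∉ Metric.ball x₀ ρ, ‖x - x₀‖⁻¹ ≤ ρ⁻¹ := fun x hx => by
    rw [mem_ball_iff_norm, not_lt] at hx
    exact inv_anti₀ hρ hx
  have hX0 : ∀ x ∉ Metric.ball x₀ ρ, X x = 0 := fun x hx => by
    rw [hX, radialField, (hlow _ (hout x hx)).1, zero_smul]
  have hX1 : ∀ x, ‖X x‖ ≤ 1 := fun x => by
    rw [hX, radialField, norm_smul, Real.norm_eq_abs, abs_of_nonneg (hHb _).1]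
    refine (mul_le_mul_of_nonneg_right (hHt _ (by positivity)) (norm_nonneg _)).trans ?_
    exact inv_mul_le_one
  have hXs : HasCompactSupport X := HasCompactSupport.of_support_subset_isCompact
    (isCompact_closedBall x₀ ρ) fun x hx => Metric.ball_subset_closedBall (by
      by_contra h
      exact hx (hX0 x h))
  have hvar := hk.2 X hXc hXs
  -- the explicit form of the divergence and its integrability
  set d : EuclideanSpace ℝ (Fin n) → ℝ := fun x => H (‖x - x₀‖⁻¹) -
      c (‖x - x₀‖⁻¹) / ‖x - x₀‖ ^ 3 * ‖(V.tangent x).starProjection (x - x₀)‖ ^ 2 with hd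
  have hdiv : V.tangentialDiv X =ᵐ[V.weight] d := ae_tangentialDiv_radialField_eq hH x₀
  have hHc : Continuous H := continuous_iff_continuousAt.2 fun t => (hH t).continuousAt
  have hdm : AEStronglyMeasurable d V.weight := by
    have h1 : Measurable fun x : EuclideanSpace ℝ (Fin n) => ‖x - x₀‖⁻¹ := by fun_prop
    refine AEMeasurable.aestronglyMeasurable ?_
    refine (hHc.measurable.comp h1).aemeasurable.sub (AEMeasurable.mul ?_
      (V.aemeasurable_norm_tangent_projection_sq x₀))
    exact ((hc.measurable.comp h1).div (by fun_prop)).aemeasurable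
  have hproj : ∀ x, 0 ≤ c (‖x - x₀‖⁻¹) / ‖x - x₀‖ ^ 3 *
        ‖(V.tangent x).starProjection (x - x₀)‖ ^ 2 ∧
      c (‖x - x₀‖⁻¹) / ‖x - x₀‖ ^ 3 * ‖(V.tangent x).starProjection (x - x₀)‖ ^ 2 ≤
        c (‖x - x₀‖⁻¹) * ‖x - x₀‖⁻¹ := fun x => by
    have hc0 := (hc01 (‖x - x₀‖⁻¹)).1
    refine ⟨by positivity, ?_⟩
    have h1 : ‖(V.tangent x).starProjection (x - x₀)‖ ^ 2 ≤ ‖x - x₀‖ ^ 2 := by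
      gcongr
      exact Submodule.norm_starProjection_apply_le _ _
    refine (mul_le_mul_of_nonneg_left h1 (by positivity)).trans (le_of_eq ?_)
    rcases eq_or_ne ‖x - x₀‖ 0 with h0 | h0
    · simp [h0]
    · field_simp
  have hcb : ∀ t, 0 ≤ t → c t * t ≤ σ⁻¹ := fun t ht => by
    rcases le_total σ⁻¹ t with h | h
    · rw [(hhigh t h).2, zero_mul]; exact (inv_pos.2 hσ).le
    · have := hc01 t
      nlinarith
  have hdi : Integrable d V.weight := by
    refine Integrable.mono' (g := (Metric.ball x₀ ρ).indicator fun _ => σ⁻¹)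
      ((integrable_indicator_iff measurableSet_ball).2 (integrableOn_const (hfin ρ))) hdm
      (Eventually.of_forall fun x => ?_)
    by_cases hx : x ∈ Metric.ball x₀ ρ
    · rw [indicator_of_mem hx, Real.norm_eq_abs, abs_le]
      have h1 := hproj x
      have h2 := hcb (‖x - x₀‖⁻¹) (by positivity)
      have h3 := hHb (‖x - x₀‖⁻¹)
      constructor <;> simp only [hd] <;> linarith [h1.1, h1.2, h3.1, h3.2]
    · rw [indicator_of_notMem hx]
      simp [hd, hlow _ (hout x hx)]
  -- pointwise lower bound of the divergence, off the centre
  have hlower : ∀ x, x ≠ x₀ → (Metric.ball x₀ σ).indicator (fun _ => σ⁻¹) x -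
      (Metric.ball x₀ ρ).indicator (fun _ => ρ⁻¹ + η) x ≤ d x := fun x hx => by
    have hx0 : 0 < ‖x - x₀‖ := norm_pos_iff.2 (sub_ne_zero.2 hx)
    have h1 := (hproj x).2
    by_cases hxρ : x ∈ Metric.ball x₀ ρ
    · rw [indicator_of_mem hxρ]
      have hτ : ρ⁻¹ ≤ ‖x - x₀‖⁻¹ := inv_anti₀ hx0 (mem_ball_iff_norm.1 hxρ).le
      by_cases hxσ : x ∈ Metric.ball x₀ σ
      · rw [indicator_of_mem hxσ]
        obtain ⟨h2, h3⟩ := hhigh _ (inv_anti₀ hx0 (mem_ball_iff_norm.1 hxσ).le)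
        have h4 := hHlow _ hab.le le_rfl
        rw [h3, zero_mul] at h1
        simp only [hd]
        rw [h2, h3]
        linarith
      · rw [indicator_of_notMem hxσ]
        have hτ' : ‖x - x₀‖⁻¹ ≤ σ⁻¹ := by
          rw [mem_ball_iff_norm, not_lt] at hxσ
          exact inv_anti₀ hσ hxσ
        have h4 := hHlow _ hτ hτ'
        have h5 : c (‖x - x₀‖⁻¹) * ‖x - x₀‖⁻¹ ≤ ‖x - x₀‖⁻¹ :=
          mul_le_of_le_one_left (by positivity) (hc01 _).2
        simp only [hd]
        linarith
    · have hxσ : x ∉ Metric.ball x₀ σ := fun h => hxρ (Metric.ball_subset_ball hσρ.le h)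
      rw [indicator_of_notMem hxρ, indicator_of_notMem hxσ]
      simp [hd, hlow _ (hout x hxρ)]
  have hiσ : Integrable ((Metric.ball x₀ σ).indicator fun _ => σ⁻¹) V.weight :=
    (integrable_indicator_iff measurableSet_ball).2 (integrableOn_const (hfin σ))
  have hiρ : Integrable ((Metric.ball x₀ ρ).indicator fun _ => ρ⁻¹ + η) V.weight :=
    (integrable_indicator_iff measurableSet_ball).2 (integrableOn_const (hfin ρ))
  have hleft : V.weight.real (Metric.ball x₀ σ) * σ⁻¹ - m * (ρ⁻¹ + η) ≤
      ∫ x, V.tangentialDiv X x ∂V.weight := by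
    rw [integral_congr_ae hdiv]
    have h1 : ∫ x, ((Metric.ball x₀ σ).indicator (fun _ => σ⁻¹) x -
        (Metric.ball x₀ ρ).indicator (fun _ => ρ⁻¹ + η) x) ∂V.weight =
        V.weight.real (Metric.ball x₀ σ) * σ⁻¹ - m * (ρ⁻¹ + η) := by
      rw [integral_sub hiσ hiρ, integral_indicator measurableSet_ball,
        integral_indicator measurableSet_ball, setIntegral_const, setIntegral_const,
        smul_eq_mul, smul_eq_mul]
    rw [← h1]
    refine integral_mono_ae (hiσ.sub hiρ) hdi ?_
    filter_upwards [measure_eq_zero_iff_ae_notMem.1 (V.weight_singleton x₀)] with x hx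
    exact hlower x hx
  have hki : IntegrableOn (fun x => ‖k x‖) (Metric.ball x₀ ρ) V.weight :=
    (hk.integrableOn_ball x₀ ρ).norm
  have hright : - ∫ x, inner ℝ (X x) (k x) ∂V.weight ≤
      ∫ x in Metric.ball x₀ ρ, ‖k x‖ ∂V.weight := by
    rw [← integral_indicator measurableSet_ball]
    refine (neg_le_abs _).trans ?_
    rw [← Real.norm_eq_abs]
    refine norm_integral_le_of_norm_le ((integrable_indicator_iff measurableSet_ball).2 hki)
      (Eventually.of_forall fun x => ?_)
    by_cases hx : x ∈ Metric.ball x₀ ρ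
    · rw [indicator_of_mem hx]
      refine (norm_inner_le_norm _ _).trans ?_
      exact mul_le_of_le_one_left (norm_nonneg _) (hX1 x)
    · rw [indicator_of_notMem hx, hX0 x hx]
      simp
  have hmη : m * η ≤ ε := by
    rw [hηdef, mul_div_assoc', div_le_iff₀ (by positivity)]
    nlinarith
  rw [div_eq_mul_inv, div_eq_mul_inv]
  linarith [mul_add m ρ⁻¹ η]

end IntegerRectifiableVarifold

namespace IntegerRectifiableVarifold

variable {n : ℕ} {V : IntegerRectifiableVarifold n}
  {k : EuclideanSpace ℝ (Fin n) → EuclideanSpace ℝ (Fin n)}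

theorem HasCurvatureNoBoundary.lintegral_enorm_ball_lt_top (hk : V.HasCurvatureNoBoundary k)
    (x₀ : EuclideanSpace ℝ (Fin n)) (ρ : ℝ) :
    ∫⁻ x in Metric.ball x₀ ρ, ‖k x‖ₑ ∂V.weight < ⊤ :=
  (hk.integrableOn_ball x₀ ρ).2

theorem HasCurvatureNoBoundary.weight_ball_div_ofReal_le (hk : V.HasCurvatureNoBoundary k)
    (x₀ : EuclideanSpace ℝ (Fin n)) {σ ρ : ℝ} (hσ : 0 < σ) (hσρ : σ < ρ) :
    V.weight (Metric.ball x₀ σ) / ENNReal.ofReal σ ≤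
      V.weight (Metric.ball x₀ ρ) / ENNReal.ofReal ρ +
        ∫⁻ x in Metric.ball x₀ ρ, ‖k x‖ₑ ∂V.weight := by
  have hρ : 0 < ρ := hσ.trans hσρ
  have hfin : ∀ R, V.weight (Metric.ball x₀ R) ≠ ⊤ := fun R => measure_ball_lt_top.ne
  have h := ENNReal.ofReal_le_ofReal (hk.weight_ball_div_le x₀ hσ hσρ)
  rwa [ENNReal.ofReal_add (by positivity) (integral_nonneg fun _ => norm_nonneg _),
    ENNReal.ofReal_div_of_pos hσ, ENNReal.ofReal_div_of_pos hρ, ofReal_measureReal (hfin σ),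
    ofReal_measureReal (hfin ρ),
    ofReal_integral_norm_eq_lintegral_enorm (hk.integrableOn_ball x₀ ρ)] at h

/-! ### Densities -/

theorem HasCurvatureNoBoundary.limsup_le (hk : V.HasCurvatureNoBoundary k)
    (x₀ : EuclideanSpace ℝ (Fin n)) {ρ : ℝ} (hρ : 0 < ρ) :
    limsup (fun σ : ℝ => V.weight (Metric.ball x₀ σ) / ENNReal.ofReal σ) (𝓝[>] 0) ≤
      V.weight (Metric.ball x₀ ρ) / ENNReal.ofReal ρ +
        ∫⁻ x in Metric.ball x₀ ρ, ‖k x‖ₑ ∂V.weight := by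
  refine limsup_le_of_le (h := ?_)
  filter_upwards [Ioo_mem_nhdsGT hρ] with σ hσ
  exact hk.weight_ball_div_ofReal_le x₀ hσ.1 hσ.2

theorem HasCurvatureNoBoundary.limsup_ne_top (hk : V.HasCurvatureNoBoundary k)
    (x₀ : EuclideanSpace ℝ (Fin n)) :
    limsup (fun σ : ℝ => V.weight (Metric.ball x₀ σ) / ENNReal.ofReal σ) (𝓝[>] 0) ≠ ⊤ := by
  refine ((hk.limsup_le x₀ one_pos).trans_lt (ENNReal.add_lt_top.2 ⟨?_, ?_⟩)).ne
  · exact ENNReal.div_lt_top measure_ball_lt_top.ne (by simp)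
  · exact hk.lintegral_enorm_ball_lt_top x₀ 1

/-- The density ratio converges as `r ↘ 0`: letting `σ` and then `ρ` tend to `0` in the monotonicity
inequality bounds its upper limit by its lower limit, because the curvature term
`∫_{B_ρ} |k| dμ_V` vanishes in the limit. -/
theorem HasCurvatureNoBoundary.tendsto_weight_ball_div (hk : V.HasCurvatureNoBoundary k)
    (x₀ : EuclideanSpace ℝ (Fin n)) :
    Tendsto (fun σ : ℝ => V.weight (Metric.ball x₀ σ) / ENNReal.ofReal σ) (𝓝[>] 0)
      (𝓝 (limsup (fun σ : ℝ => V.weight (Metric.ball x₀ σ) / ENNReal.ofReal σ) (𝓝[>] 0))) := by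
  set q : ℝ → ℝ≥0∞ := fun σ => V.weight (Metric.ball x₀ σ) / ENNReal.ofReal σ with hq
  set I : ℝ → ℝ≥0∞ := fun ρ => ∫⁻ x in Metric.ball x₀ ρ, ‖k x‖ₑ ∂V.weight with hI
  have hev : ∀ᶠ ρ : ℝ in 𝓝[>] 0, 0 < ρ ∧ ρ < 1 := by
    filter_upwards [Ioo_mem_nhdsGT (zero_lt_one' ℝ)] with η hη using hη
  -- the monotonicity inequality makes `μ_V(B_ρ)` at most linear in `ρ`
  have hμ : Tendsto (fun ρ : ℝ => V.weight.restrict (Metric.ball x₀ 1) (Metric.ball x₀ ρ))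
      (𝓝[>] 0) (𝓝 0) := by
    have hC : q 1 + I 1 ≠ ⊤ := (ENNReal.add_lt_top.2
      ⟨ENNReal.div_lt_top measure_ball_lt_top.ne (by simp), hk.lintegral_enorm_ball_lt_top x₀ 1⟩).ne
    have h0 : Tendsto (fun ρ : ℝ => (q 1 + I 1) * ENNReal.ofReal ρ) (𝓝[>] 0) (𝓝 0) := by
      have h1 : Tendsto (fun ρ : ℝ => ENNReal.ofReal ρ) (𝓝[>] 0) (𝓝 0) := by
        have := (ENNReal.continuous_ofReal.tendsto 0).mono_left
          (nhdsWithin_le_nhds (s := Ioi (0 : ℝ)))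
        rwa [ENNReal.ofReal_zero] at this
      simpa using ENNReal.Tendsto.const_mul h1 (Or.inr hC)
    refine tendsto_of_tendsto_of_tendsto_of_le_of_le' tendsto_const_nhds h0
      (Eventually.of_forall fun _ => zero_le) ?_
    filter_upwards [hev] with ρ hρ
    refine (Measure.restrict_le_self _).trans ?_
    exact (ENNReal.div_le_iff (by simpa using hρ.1) ENNReal.ofReal_ne_top).1
      (hk.weight_ball_div_ofReal_le x₀ hρ.1 hρ.2)
  have hI0 : Tendsto I (𝓝[>] 0) (𝓝 0) := by
    have := tendsto_setLIntegral_zero (μ := V.weight.restrict (Metric.ball x₀ 1))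
      (f := fun x => ‖k x‖ₑ) (hk.lintegral_enorm_ball_lt_top x₀ 1).ne hμ
    refine this.congr' ?_
    filter_upwards [hev] with ρ hρ
    rw [Measure.restrict_restrict_of_subset (Metric.ball_subset_ball hρ.2.le)]
  refine tendsto_of_le_liminf_of_limsup_le ?_ le_rfl
  refine ENNReal.le_of_forall_pos_le_add fun ε hε _ => ?_
  rw [← tsub_le_iff_right]
  refine le_liminf_of_le (h := ?_)
  filter_upwards [hev, hI0.eventually (gt_mem_nhds (ENNReal.coe_pos.2 hε))] with ρ hρ hIρ
  rw [tsub_le_iff_right]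
  exact (hk.limsup_le x₀ hρ.1).trans (by gcongr)

variable (V) in
/-- The upper density `limsup_{r ↘ 0} μ_V(B_r(x)) / (2r)`. -/
noncomputable def upperDensity (x : EuclideanSpace ℝ (Fin n)) : ℝ≥0∞ :=
  limsup (fun σ : ℝ => V.weight (Metric.ball x σ) / ENNReal.ofReal σ) (𝓝[>] 0) / 2

theorem HasCurvatureNoBoundary.hasDensity_upperDensity (hk : V.HasCurvatureNoBoundary k)
    (x : EuclideanSpace ℝ (Fin n)) : V.HasDensity x (V.upperDensity x) := by
  have h := ENNReal.Tendsto.div_const (hk.tendsto_weight_ball_div x)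
    (b := 2) (Or.inr two_ne_zero)
  refine h.congr fun r => ?_
  rw [ENNReal.ofReal_mul zero_le_two, ENNReal.ofReal_ofNat, div_eq_mul_inv, div_eq_mul_inv,
    div_eq_mul_inv, ENNReal.mul_inv (by simp) (by simp), mul_assoc, mul_comm (2⁻¹ : ℝ≥0∞)]

/-- For finite total mass the term `μ_V(B_ρ) / ρ` of the monotonicity inequality vanishes as
`ρ → ∞`. -/
theorem HasCurvatureNoBoundary.limsup_le_lintegral (hk : V.HasCurvatureNoBoundary k)
    (hV : V.weight univ < ⊤) (x : EuclideanSpace ℝ (Fin n)) :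
    limsup (fun σ : ℝ => V.weight (Metric.ball x σ) / ENNReal.ofReal σ) (𝓝[>] 0) ≤
      ∫⁻ x, ‖k x‖ₑ ∂V.weight := by
  have h0 : Tendsto (fun ρ : ℝ => V.weight univ / ENNReal.ofReal ρ + ∫⁻ x, ‖k x‖ₑ ∂V.weight)
      atTop (𝓝 (∫⁻ x, ‖k x‖ₑ ∂V.weight)) := by
    have h1 : Tendsto (fun ρ : ℝ => V.weight univ / ENNReal.ofReal ρ) atTop (𝓝 0) := by
      have := ENNReal.Tendsto.const_div ENNReal.tendsto_ofReal_atTop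
        (a := V.weight univ) (Or.inr hV.ne)
      simpa using this
    simpa using h1.add_const (∫⁻ x, ‖k x‖ₑ ∂V.weight)
  refine ge_of_tendsto h0 ?_
  filter_upwards [eventually_gt_atTop 0] with ρ hρ
  refine (hk.limsup_le x hρ).trans ?_
  gcongr
  · exact subset_univ _
  · exact Measure.restrict_le_self

theorem HasCurvatureNoBoundary.upperDensity_le (hk : V.HasCurvatureNoBoundary k)
    (hV : V.weight univ < ⊤) (x : EuclideanSpace ℝ (Fin n)) :
    V.upperDensity x ≤ V.energy k 1 / 2 := by
  rw [upperDensity, energy]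
  gcongr
  simpa using hk.limsup_le_lintegral hV x

theorem HasCurvatureNoBoundary.ae_weight_upperDensity_eq (hk : V.HasCurvatureNoBoundary k) :
    ∀ᵐ x ∂V.weight, V.upperDensity x = V.mult x := by
  filter_upwards [V.ae_isApproxTangent_tangent] with x hx
  have hlim := (ENNReal.tendsto_toReal (hk.limsup_ne_top x)).comp (hk.tendsto_weight_ball_div x)
  have hD := hx.density_eq (hlim.congr' (by
    filter_upwards [self_mem_nhdsWithin] with r (hr : 0 < r)
    simp only [Function.comp_apply]
    rw [ENNReal.toReal_div, ENNReal.toReal_ofReal hr.le, measureReal_def]))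
  rw [upperDensity, ← ENNReal.ofReal_toReal (hk.limsup_ne_top x), hD,
    ENNReal.ofReal_mul zero_le_two, ENNReal.ofReal_ofNat, ENNReal.ofReal_natCast,
    mul_comm, ENNReal.mul_div_cancel_right two_ne_zero (by simp)]

/-- The density agrees with the multiplicity also `ℋ¹`-a.e. off `Γ`, where both vanish. -/
theorem HasCurvatureNoBoundary.ae_upperDensity_eq (hk : V.HasCurvatureNoBoundary k) :
    ∀ᵐ x ∂(Measure.hausdorffMeasure 1 : Measure (EuclideanSpace ℝ (Fin n))),
      V.upperDensity x = V.mult x := by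
  have hoff := measure_eq_zero_iff_ae_notMem.1
    (hausdorffMeasure_one_not_tendsto_div_zero V.weight V.weight_compl_carrier)
  filter_upwards [V.ae_hausdorffMeasure_of_ae_weight hk.ae_weight_upperDensity_eq, hoff]
    with x hx hx'
  by_cases hxc : x ∈ V.carrier
  · exact hx hxc
  have h0 := not_not.1 fun h => hx' ⟨hxc, h⟩
  have h1 : Tendsto (fun σ : ℝ => V.weight (Metric.ball x σ) / ENNReal.ofReal σ) (𝓝[>] 0)
      (𝓝 0) := by
    refine tendsto_of_tendsto_of_tendsto_of_le_of_le tendsto_const_nhds h0 (fun _ => zero_le)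
      fun r => ?_
    dsimp only
    gcongr
    exact Metric.ball_subset_closedBall
  rw [upperDensity, h1.limsup_eq, V.mult_eq_zero x hxc]
  simp

/-- At some point of `Γ` the density equals the multiplicity, hence is at least `1`, whereas it is
nowhere larger than half the energy. -/
theorem HasCurvatureNoBoundary.two_le_energy (hk : V.HasCurvatureNoBoundary k) (hV0 : V.weight ≠ 0)
    (hV : V.weight univ < ⊤) : 2 ≤ V.energy k 1 := by
  have : (ae V.weight).NeBot := ae_neBot.2 hV0
  obtain ⟨x, hx, hxc⟩ := (hk.ae_weight_upperDensity_eq.and V.ae_mem_carrier).exists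
  have h1 : (1 : ℝ≥0∞) ≤ V.energy k 1 / 2 := by
    refine le_trans ?_ (hk.upperDensity_le hV x)
    rw [hx]
    exact_mod_cast V.one_le_mult x hxc
  rw [ENNReal.le_div_iff_mul_le (by simp) (by simp), one_mul] at h1
  exact h1

/-- Hölder's inequality between the energies. -/
theorem energy_one_le (hk : AEStronglyMeasurable k V.weight) {p : ℝ} (hp : 1 ≤ p) :
    V.energy k 1 ≤ V.weight univ ^ (1 - 1 / p) * V.energy k p ^ (1 / p) := by
  have hp0 : 0 < p := one_pos.trans_le hp
  have h := eLpNorm_le_eLpNorm_mul_rpow_measure_univ (p := 1) (q := ENNReal.ofReal p)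
    (by rwa [ENNReal.one_le_ofReal]) hk
  rw [eLpNorm_one_eq_lintegral_enorm, eLpNorm_eq_lintegral_rpow_enorm_toReal (by simpa using hp0)
    ENNReal.ofReal_ne_top, ENNReal.toReal_ofReal hp0.le, ENNReal.toReal_one, div_one,
    mul_comm] at h
  simpa [energy] using h

end IntegerRectifiableVarifold

theorem theorem2p2 (n : ℕ) (V : IntegerRectifiableVarifold n) (hV : V.weight ≠ 0)
    (k : EuclideanSpace ℝ (Fin n) → EuclideanSpace ℝ (Fin n)) (hk : V.HasCurvatureNoBoundary k)
    (p : ℝ) (hp : 1 ≤ p) (hE : V.energy k p < ⊤) :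
    (∀ x₀ : EuclideanSpace ℝ (Fin n),
      limsup (fun σ : ℝ => V.weight (Metric.ball x₀ σ) / ENNReal.ofReal σ) (𝓝[>] 0) ≤
        liminf (fun ρ : ℝ => V.weight (Metric.ball x₀ ρ) / ENNReal.ofReal ρ +
          ∫⁻ x in Metric.ball x₀ ρ, ‖k x‖ₑ ∂V.weight) atTop) ∧
    (V.weight univ < ⊤ →
      (2 ≤ V.energy k 1 ∧
        V.energy k 1 ≤ V.weight univ ^ (1 - 1 / p) * V.energy k p ^ (1 / p)) ∧
      (1 < p →
        ∃ Θ : EuclideanSpace ℝ (Fin n) → ℝ≥0∞,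
          (∀ᵐ x ∂(Measure.hausdorffMeasure 1 : Measure (EuclideanSpace ℝ (Fin n))),
            Θ x = V.mult x) ∧
          ∀ x, V.HasDensity x (Θ x) ∧ Θ x ≤ V.energy k 1 / 2) ∧
      (p = 1 →
        ∀ᵐ x ∂(Measure.hausdorffMeasure 1 : Measure (EuclideanSpace ℝ (Fin n))),
          (V.mult x : ℝ≥0∞) ≤ V.energy k 1 / 2) ∧
      (p = 1 →
        (∃ R : ℝ, Measure.hausdorffMeasure 1 (V.carrier \ Metric.ball 0 R) = 0) →
        ∃ Θ : EuclideanSpace ℝ (Fin n) → ℝ≥0∞,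
          (∀ᵐ x ∂(Measure.hausdorffMeasure 1 : Measure (EuclideanSpace ℝ (Fin n))),
            Θ x = V.mult x) ∧
          ∀ x, V.HasDensity x (Θ x) ∧ Θ x ≤ V.energy k 1 / 2)) := by
  refine ⟨fun x₀ => le_liminf_of_le (h := ?_), fun hfin => ?_⟩
  · filter_upwards [eventually_gt_atTop 0] with ρ hρ using hk.limsup_le x₀ hρ
  have hdens : ∃ Θ : EuclideanSpace ℝ (Fin n) → ℝ≥0∞,
      (∀ᵐ x ∂(Measure.hausdorffMeasure 1 : Measure (EuclideanSpace ℝ (Fin n))),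
        Θ x = V.mult x) ∧
      ∀ x, V.HasDensity x (Θ x) ∧ Θ x ≤ V.energy k 1 / 2 :=
    ⟨V.upperDensity, hk.ae_upperDensity_eq,
      fun x => ⟨hk.hasDensity_upperDensity x, hk.upperDensity_le hfin x⟩⟩
  refine ⟨⟨hk.two_le_energy hV hfin,
    V.energy_one_le hk.1.aestronglyMeasurable hp⟩, fun _ => hdens, fun _ => ?_, fun _ _ => hdens⟩
  obtain ⟨Θ, hΘ, h⟩ := hdens
  filter_upwards [hΘ] with x hx
  rw [← hx]
  exact (h x).2
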